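/- Theorem (slicing theorem). Let $Q$ be the space of homogeneous quintic polynomials in $z_1,\dots,z_5$ over $\mathbb{C}$ (including $0$). For $m\in\mathbb{Z}_{\ge 0}^5$ with $|m|=5$ let $z^m$ be the corresponding monomial, let $m_0=(1,1,1,1,1)$, and let $\Delta^0$ be the set of those $m$ that have at least two vanishing entries (the lattice points of the 2-skeleton of the Newton simplex of quintics). Let $p_\infty=z^{m_0}=z_1z_2z_3z_4z_5$ and $Q_0=p_\infty+\mathrm{Span}_{\mathbb{C}}\{z^m: m\in\Delta^0\}$. Matrices act by $F(z)\mapsto F(Az)$. Let $T$ be the group of diagonal matrices in $SL(5,\mathbb{C})$, and let $S_5$, the Weyl group of $SL(5,\mathbb{C})$, act by permuting the variables. Measure distances in $Q$ by the largest absolute value of a difference of coefficients. For $\varepsilon>0$ let $V_\varepsilon$ be the union of the $T$-orbits of the points of $Q_0$ at distance $<\varepsilon$ from $p_\infty$, and let $U_\varepsilon\subset Q$ be the set of the quintics whose $GL(5,\mathbb{C})$-orbit meets $V_\varepsilon$. Then: (1) $p_\infty\in Q_0\subset Q$, and $Q_0$ is $T$-invariant. (2) There is $\varepsilon_0>0$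 such that for all $0<\varepsilon\le\varepsilon_0$: the set $U_\varepsilon$ is an open neighbourhood of $p_\infty$ in $Q$; if $g\in GL(5,\mathbb{C})$ maps a point of $V_\varepsilon$ to a point of $V_\varepsilon$, then $g$ is the product of an element of $T$ and a permutation matrix; and for each $p\in U_\varepsilon$ the set $GL(5,\mathbb{C})p\cap V_\varepsilon$ consists of finitely many $T$-orbits, indexed by a quotient of $S_5$: for each $q$ in this set there is a subgroup $H\le S_5$ such that $\sigma H\mapsto T\cdot(\sigma q)$ is a well-defined bijection from $S_5/H$ onto the set of the $T$-orbits contained in $GL(5,\mathbb{C})p\cap V_\varepsilon$. (3) For a quintic $F$ let $\psi(F)$ be its coefficient of $z^{m_0}$, and let $B(F)$ be the $5\times5$ matrix with zero diagonal whose $(j,k)$ entry, for $j\ne k$, is the coefficient in $F$ of $z^{m_0-e_j+e_k}$. Put $F_0=F$, $L_{l+1}=I-\psi(F_l)^{-1}B(F_l)$ and $F_{l+1}(z)=F_l(L_{l+1}z)$ for $l\ge 0$. For every $c\in\mathbb{R}$ there are $R>0$ and $K$ such that for every $F\in Q$ with $|\psi(F)|\ge R$ whose other coefficients are all of absolute value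 $\le c$: every entry of $L_l-I$ has absolute value at most $(K/|\psi(F)|)^l$ for all $l\ge1$, the products $L_1L_2\cdots L_l$ converge as $l\to\infty$ to an invertible matrix $L$, the coefficient $\psi'$ of $z^{m_0}$ in $F(Lz)$ is nonzero, and $F(Lz)/\psi'\in Q_0$; that is, $F(Lz)=\psi' z^{m_0}+\sum_{m\in\Delta^0}a'_mz^m$. -/

import Mathlib

open MvPolynomial Matrix Filter Topology

noncomputable section

namespace Quintic

/-- Polynomials in the five variables `z₁, …, z₅` over `ℂ`. -/
abbrev Poly := MvPolynomial (Fin 5) ℂ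

/-- The exponent `m₀ = (1,1,1,1,1)`. -/
def m₀ : Fin 5 →₀ ℕ := Finsupp.equivFunOnFinite.symm fun _ => 1

/-- The large complex limit `p_∞ = z₁ z₂ z₃ z₄ z₅`. -/
def pInf : Poly := ∏ i, X i

/-- `Q`, the space of homogeneous quintic polynomials (together with zero). -/
def Q : Submodule ℂ Poly := homogeneousSubmodule (Fin 5) ℂ 5

/-- The lattice points of the simplex `Δ`: exponents of total degree five. -/
def Δ : Set (Fin 5 →₀ ℕ) := {m | ∑ i, m i = 5}

/-- The lattice points of the 2-skeleton of `Δ`: at least two of the exponents vanish. -/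
def Δ₀ : Set (Fin 5 →₀ ℕ) := {m | m ∈ Δ ∧ ∃ i j, i ≠ j ∧ m i = 0 ∧ m j = 0}

/-- The linear span of the monomials `z^m` with `m ∈ Δ⁰`. -/
def spanΔ₀ : Submodule ℂ Poly := Submodule.span ℂ ((fun m => monomial m (1 : ℂ)) '' Δ₀)

/-- The affine subspace `Q₀ = m₀ + Span(Δ⁰)`. -/
def Q₀ : AffineSubspace ℂ Poly := AffineSubspace.mk' pInf spanΔ₀

/-- The polynomial `F(Az)`. -/
def subst (A : Matrix (Fin 5) (Fin 5) ℂ) (F : Poly) : Poly :=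
  bind₁ (fun j => ∑ k, C (A j k) * X k) F

/-- The diagonal maximal torus `T` of `SL(5,ℂ)`. -/
def torus : Subgroup (Matrix.SpecialLinearGroup (Fin 5) ℂ) where
  carrier := {g | ∃ t : Fin 5 → ℂ, (g : Matrix (Fin 5) (Fin 5) ℂ) = diagonal t}
  one_mem' := ⟨fun _ => 1, by simp⟩
  mul_mem' := by
    rintro a b ⟨s, hs⟩ ⟨t, ht⟩
    exact ⟨fun i => s i * t i, by simp [hs, ht, diagonal_mul_diagonal]⟩
  inv_mem' := by
    rintro a ⟨s, hs⟩
    exact ⟨fun i => ∏ j ∈ Finset.univ.erase i, s j, by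
      have h : ((a⁻¹ : Matrix.SpecialLinearGroup (Fin 5) ℂ) : Matrix (Fin 5) (Fin 5) ℂ) =
          adjugate (a : Matrix (Fin 5) (Fin 5) ℂ) := Matrix.SpecialLinearGroup.coe_inv a
      rw [h, hs, adjugate_diagonal]⟩

/-- The orbit of `F` under linear changes of variables in `GL(5,ℂ)`. -/
def glOrbit (F : Poly) : Set Poly :=
  {G | ∃ g : GL (Fin 5) ℂ, G = subst (g : Matrix (Fin 5) (Fin 5) ℂ) F}

/-- The orbit of `F` under the maximal torus `T`. -/
def torusOrbit (F : Poly) : Set Poly :=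
  {G | ∃ t ∈ torus, G = subst (t : Matrix (Fin 5) (Fin 5) ℂ) F}

/-- All coefficients of `F` and `G` differ by less than `ε`. -/
def Near (ε : ℝ) (F G : Poly) : Prop := ∀ m, ‖coeff m F - coeff m G‖ < ε

/-- The part of `Q₀` near `p_∞`: the `T`-orbits of the points of `Q₀` that are `ε`-close to `p_∞`
(the torus is not compact, so that a `T`-invariant neighbourhood cannot be bounded). -/
def slice (ε : ℝ) : Set Poly := {q | ∃ q₁ ∈ Q₀, Near ε q₁ pInf ∧ q ∈ torusOrbit q₁}

/-- The quintics whose `GL(5,ℂ)`-orbit meets the part of `Q₀` near `p_∞`. -/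
def nearby (ε : ℝ) : Set Poly := {p | p ∈ Q ∧ (glOrbit p ∩ slice ε).Nonempty}

/-- The exponent `m_{jk} = m₀ - e_j + e_k`. -/
def mShift (j k : Fin 5) : Fin 5 →₀ ℕ := m₀ - Finsupp.single j 1 + Finsupp.single k 1

/-- The matrix `I - ψ⁻¹ B`, where `ψ` is the coefficient of `z^{m₀}` in `F`, and where `B` is the
matrix of the coefficients of `z^{m_{jk}}`, `j ≠ k`, with zero diagonal. -/
def step (F : Poly) : Matrix (Fin 5) (Fin 5) ℂ :=
  1 - (coeff m₀ F)⁻¹ • Matrix.of fun j k => if j = k then 0 else coeff (mShift j k) F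

/-- `F_0 = F` and `F_{l+1}(z) = F_l(L_{l+1} z)`, where `L_{l+1}` is the matrix `step F_l`. -/
def iter (F : Poly) : ℕ → Poly
  | 0 => F
  | l + 1 => subst (step (iter F l)) (iter F l)

/-- The partial product `L_1 L_2 ⋯ L_l`. -/
def partialProd (F : Poly) : ℕ → Matrix (Fin 5) (Fin 5) ℂ
  | 0 => 1
  | l + 1 => partialProd F l * step (iter F l)

end Quintic

end

noncomputable section

namespace Quintic

/-! To first order, the substitution `1 + N` changes `p_∞` by `∑ N_jk z^{m_jk}`, so infinitesimal
linear changes of variables move `p_∞` exactly in the directions `z^{m₀}` and `z^{m_jk}`. Every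
other monomial of degree five lies in `Δ⁰` (`mem_Δ_cases`), so `Q₀` is a complement to these
directions.

Normal form. The matrix `step F` is the Newton correction that cancels the coefficients of the
`z^{m_jk}` to first order at `p_∞`. By `l1_subst_step_le` the new ones are bounded by the old ones
times the relative size of the off-`z^{m₀}` part, so they decay geometrically (`iter_bounds`). The
product of the steps converges to an invertible matrix near the identity (`exists_normalForm`), and
rescaling to `ψ = 1` gives the statement for large `ψ`. Applied to perturbations of points of `Q₀`
near `p_∞`, the same iteration gives openness (`isOpen_nearby`): the limit stays close to the
unperturbed point, and scalars are absorbed by fifth roots.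

Rigidity. Suppose `A` maps a point of `Q₀` near `p_∞` to another such point. As `GL(5,ℂ)` is not
compact, a local argument at the identity is not enough. Complete pivoting
(`exists_complete_pivoting`) gives `PAP' V = L D` with permutation matrices `P`, `P'`, with `L`
lower and `V` upper unitriangular, both bounded independently of `A`, and with a diagonal `D` whose
entries essentially decrease. After permuting variables, `q₁(LDz) = q₂(Vz)`. A lower unitriangular
substitution creates from `p_∞` no `z^{m_jk}` with `j < k`, an upper one none with `j > k`.
Comparing coefficients, with the order of the pivots controlling the ratios `d_j / d_k`, makes all
coefficients that detect `L` and `V` small relative to `n`, the largest off-diagonal entry. This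
yields `n ≤ n/2`, hence `L = V = 1` (`eq_one_of_subst_eq`), and `A` is monomial.

Counting. Permutations preserve both the slice and the `GL`-orbit and normalize `T`. By rigidity the
`T`-orbits in question are thus the translates of one of them by `S₅`, and orbit–stabilizer applies
(`torusOrbit_image_eq_range`, `exists_equiv_range_torusOrbit`). -/

/-! ### The `ℓ¹` norm of the coefficients -/

/-- The sum of the absolute values of the coefficients. -/
def l1 (F : Poly) : ℝ := ∑ m ∈ F.support, ‖coeff m F‖

lemma l1_nonneg (F : Poly) : 0 ≤ l1 F := Finset.sum_nonneg fun _ _ => norm_nonneg _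

lemma l1_eq_sum {F : Poly} {s : Finset (Fin 5 →₀ ℕ)} (h : F.support ⊆ s) :
    l1 F = ∑ m ∈ s, ‖coeff m F‖ :=
  Finset.sum_subset h fun m _ hm => by simpa using hm

lemma norm_coeff_le_l1 (m : Fin 5 →₀ ℕ) (F : Poly) : ‖coeff m F‖ ≤ l1 F := by
  by_cases hm : m ∈ F.support
  · exact Finset.single_le_sum (f := fun m => ‖coeff m F‖) (fun _ _ => norm_nonneg _) hm
  · rw [notMem_support_iff.mp hm, norm_zero]
    exact l1_nonneg F

@[simp] lemma l1_zero : l1 0 = 0 := by simp [l1]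

lemma l1_add_le (F G : Poly) : l1 (F + G) ≤ l1 F + l1 G := by
  classical
  rw [l1_eq_sum (support_add (p := F) (q := G)),
    l1_eq_sum (Finset.subset_union_left (s₁ := F.support) (s₂ := G.support)),
    l1_eq_sum (Finset.subset_union_right (s₁ := F.support) (s₂ := G.support)),
    ← Finset.sum_add_distrib]
  exact Finset.sum_le_sum fun m _ => by rw [coeff_add]; exact norm_add_le _ _

lemma l1_sum_le {ι : Type*} (s : Finset ι) (f : ι → Poly) :
    l1 (∑ i ∈ s, f i) ≤ ∑ i ∈ s, l1 (f i) := by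
  classical
  induction s using Finset.induction_on with
  | empty => simp
  | insert a s ha ih =>
    rw [Finset.sum_insert ha, Finset.sum_insert ha]
    exact (l1_add_le _ _).trans (by linarith)

lemma l1_smul (c : ℂ) (F : Poly) : l1 (c • F) = ‖c‖ * l1 F := by
  rw [l1_eq_sum (support_smul (a := c) (f := F)), l1, Finset.mul_sum]
  exact Finset.sum_congr rfl fun m _ => by rw [coeff_smul, smul_eq_mul, norm_mul]

lemma l1_neg (F : Poly) : l1 (-F) = l1 F := by
  simpa using l1_smul (-1) F

lemma l1_sub_le (F G : Poly) : l1 (F - G) ≤ l1 F + l1 G := by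
  rw [sub_eq_add_neg, ← l1_neg G]
  exact l1_add_le _ _

lemma l1_monomial (m : Fin 5 →₀ ℕ) (c : ℂ) : l1 (monomial m c) = ‖c‖ := by
  classical
  rw [l1_eq_sum (support_monomial_subset (s := m) (a := c))]
  simp

lemma l1_X (i : Fin 5) : l1 (X i) = 1 := by
  rw [X, l1_monomial, norm_one]

lemma l1_one : l1 1 = 1 := by
  have h := l1_monomial 0 1
  rwa [norm_one] at h

lemma l1_monomial_mul (m : Fin 5 →₀ ℕ) (c : ℂ) (G : Poly) :
    l1 (monomial m c * G) ≤ ‖c‖ * l1 G := by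
  classical
  conv_lhs => rw [G.as_sum, Finset.mul_sum]
  refine (l1_sum_le _ _).trans ?_
  rw [l1, Finset.mul_sum]
  exact Finset.sum_le_sum fun k _ => by rw [monomial_mul, l1_monomial, norm_mul]

lemma l1_mul_le (F G : Poly) : l1 (F * G) ≤ l1 F * l1 G := by
  conv_lhs => rw [F.as_sum, Finset.sum_mul]
  refine (l1_sum_le _ _).trans ?_
  conv_rhs => rw [l1, Finset.sum_mul]
  exact Finset.sum_le_sum fun k _ => l1_monomial_mul _ _ _

lemma l1_mul_le_of_le {F G : Poly} {a b : ℝ} (hF : l1 F ≤ a) (hG : l1 G ≤ b) :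
    l1 (F * G) ≤ a * b :=
  (l1_mul_le F G).trans (mul_le_mul hF hG (l1_nonneg G) ((l1_nonneg F).trans hF))

/-! ### Perturbation of products -/

section Products

variable {ι : Type*} {x y : ι → Poly} {n : ℝ}

lemma l1_prod_le {a : ℝ} (s : Finset ι) (hx : ∀ i ∈ s, l1 (x i) ≤ a) :
    l1 (∏ i ∈ s, x i) ≤ a ^ s.card := by
  classical
  induction s using Finset.induction_on with
  | empty => simp [l1_one]
  | insert a s ha ih =>
    rw [Finset.prod_insert ha, Finset.card_insert_of_notMem ha, pow_succ']
    exact l1_mul_le_of_le (hx _ (by simp)) (ih fun i hi => hx i (by simp [hi]))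

/-- Since `l1` is submultiplicative, the expansion is dominated term by term by that of `(1 + n) ^
s.card` without its constant term. -/
lemma l1_prod_add_sub_prod_le (hx : ∀ i, l1 (x i) ≤ 1) (hy : ∀ i, l1 (y i) ≤ n)
    (s : Finset ι) :
    l1 (∏ i ∈ s, (x i + y i) - ∏ i ∈ s, x i) ≤ (1 + n) ^ s.card - 1 := by
  classical
  induction s using Finset.induction_on with
  | empty => simp
  | insert a s ha ih =>
    rw [Finset.prod_insert ha, Finset.prod_insert ha, Finset.card_insert_of_notMem ha, pow_succ']
    have e : (x a + y a) * ∏ i ∈ s, (x i + y i) - x a * ∏ i ∈ s, x i =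
        (x a + y a) * (∏ i ∈ s, (x i + y i) - ∏ i ∈ s, x i) + y a * ∏ i ∈ s, x i := by ring
    rw [e]
    have h1 : l1 (∏ i ∈ s, x i) ≤ 1 := (l1_prod_le s fun i _ => hx i).trans (by simp)
    have h2 : l1 (x a + y a) ≤ 1 + n := (l1_add_le _ _).trans (add_le_add (hx a) (hy a))
    have h3 := l1_mul_le_of_le h2 ih
    have h4 := l1_mul_le_of_le (hy a) h1
    have h5 := l1_add_le ((x a + y a) * (∏ i ∈ s, (x i + y i) - ∏ i ∈ s, x i))
      (y a * ∏ i ∈ s, x i)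
    linarith

/-- The same domination, now with the terms of degree one in `n` removed as well; what remains is
quadratic, which is what makes the Newton step for `p_∞` effective. -/
lemma l1_prod_add_second_order_le [DecidableEq ι] (hx : ∀ i, l1 (x i) ≤ 1)
    (hy : ∀ i, l1 (y i) ≤ n) (s : Finset ι) :
    l1 (∏ i ∈ s, (x i + y i) - ∏ i ∈ s, x i - ∑ i ∈ s, y i * ∏ j ∈ s.erase i, x j) ≤
      (1 + n) ^ s.card - 1 - s.card * n := by
  induction s using Finset.induction_on with
  | empty => simp
  | insert a s ha ih =>
    have hsum : ∑ i ∈ insert a s, y i * ∏ j ∈ (insert a s).erase i, x j =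
        y a * ∏ j ∈ s, x j + x a * ∑ i ∈ s, y i * ∏ j ∈ s.erase i, x j := by
      rw [Finset.sum_insert ha, Finset.erase_insert ha, Finset.mul_sum]
      congr 1
      refine Finset.sum_congr rfl fun i hi => ?_
      have hia : a ≠ i := fun h => ha (h ▸ hi)
      rw [Finset.erase_insert_of_ne hia,
        Finset.prod_insert fun h => ha (Finset.mem_of_mem_erase h)]
      ring
    rw [hsum, Finset.prod_insert ha, Finset.prod_insert ha, Finset.card_insert_of_notMem ha,
      pow_succ']
    have hD : l1 (∑ i ∈ s, y i * ∏ j ∈ s.erase i, x j) ≤ s.card * n := by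
      refine (l1_sum_le _ _).trans ((Finset.sum_le_card_nsmul s _ n fun i _ => ?_).trans
        (by simp))
      have h1 : l1 (∏ j ∈ s.erase i, x j) ≤ 1 := (l1_prod_le _ fun i _ => hx i).trans (by simp)
      simpa using l1_mul_le_of_le (hy i) h1
    set P := ∏ i ∈ s, x i
    set D := ∑ i ∈ s, y i * ∏ j ∈ s.erase i, x j
    set R := ∏ i ∈ s, (x i + y i)
    have e : (x a + y a) * R - x a * P - (y a * P + x a * D) =
        (x a + y a) * (R - P - D) + y a * D := by ring
    rw [e]
    have h2 : l1 (x a + y a) ≤ 1 + n := (l1_add_le _ _).trans (add_le_add (hx a) (hy a))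
    have h3 := l1_mul_le_of_le h2 ih
    have h4 := l1_mul_le_of_le (hy a) hD
    have h5 := l1_add_le ((x a + y a) * (R - P - D)) (y a * D)
    push_cast
    nlinarith

end Products

/-! ### Substitution of linear forms -/

/-- The linear form given by row `j` of a matrix. -/
def linForm (A : Matrix (Fin 5) (Fin 5) ℂ) (j : Fin 5) : Poly := ∑ k, C (A j k) * X k

lemma subst_eq (A : Matrix (Fin 5) (Fin 5) ℂ) (F : Poly) : subst A F = bind₁ (linForm A) F := rfl

lemma linForm_one_add (N : Matrix (Fin 5) (Fin 5) ℂ) (j : Fin 5) :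
    linForm (1 + N) j = X j + linForm N j := by
  simp [linForm, Matrix.one_apply, add_mul, Finset.sum_add_distrib]

lemma l1_linForm_le (A : Matrix (Fin 5) (Fin 5) ℂ) (j : Fin 5) :
    l1 (linForm A j) ≤ ∑ k, ‖A j k‖ :=
  (l1_sum_le _ _).trans (Finset.sum_le_sum fun k _ => by
    rw [C_mul_X_eq_monomial, l1_monomial])

lemma subst_add (A : Matrix (Fin 5) (Fin 5) ℂ) (F G : Poly) :
    subst A (F + G) = subst A F + subst A G := map_add (bind₁ (linForm A)) F G

lemma subst_sub (A : Matrix (Fin 5) (Fin 5) ℂ) (F G : Poly) :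
    subst A (F - G) = subst A F - subst A G := map_sub (bind₁ (linForm A)) F G

lemma subst_mul (A : Matrix (Fin 5) (Fin 5) ℂ) (F G : Poly) :
    subst A (F * G) = subst A F * subst A G := map_mul (bind₁ (linForm A)) F G

lemma subst_smul (A : Matrix (Fin 5) (Fin 5) ℂ) (c : ℂ) (F : Poly) :
    subst A (c • F) = c • subst A F := map_smul (bind₁ (linForm A)) c F

lemma subst_sum {ι : Type*} (A : Matrix (Fin 5) (Fin 5) ℂ) (s : Finset ι) (f : ι → Poly) :
    subst A (∑ i ∈ s, f i) = ∑ i ∈ s, subst A (f i) := map_sum (bind₁ (linForm A)) f s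

lemma subst_prod {ι : Type*} (A : Matrix (Fin 5) (Fin 5) ℂ) (s : Finset ι) (f : ι → Poly) :
    subst A (∏ i ∈ s, f i) = ∏ i ∈ s, subst A (f i) := map_prod (bind₁ (linForm A)) f s

lemma subst_C (A : Matrix (Fin 5) (Fin 5) ℂ) (c : ℂ) : subst A (C c) = C c := by
  simp [subst]

lemma subst_X (A : Matrix (Fin 5) (Fin 5) ℂ) (j : Fin 5) : subst A (X j) = linForm A j := by
  rw [subst_eq, bind₁_X_right]

lemma subst_one (F : Poly) : subst 1 F = F := by
  have : linForm 1 = X := by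
    ext1 j
    simp [linForm, Matrix.one_apply]
  rw [subst_eq, this, bind₁_X_left, AlgHom.id_apply]

lemma subst_subst (A B : Matrix (Fin 5) (Fin 5) ℂ) (F : Poly) :
    subst B (subst A F) = subst (A * B) F := by
  have h : (fun j => bind₁ (linForm B) (linForm A j)) = linForm (A * B) := by
    ext1 j
    simp only [linForm, map_sum, map_mul, bind₁_C_right, bind₁_X_right, Matrix.mul_apply,
      Finset.mul_sum, Finset.sum_mul]
    rw [Finset.sum_comm]
    simp only [mul_assoc]
  rw [subst_eq, subst_eq, bind₁_bind₁, h, subst_eq]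

lemma mem_Δ_iff {m : Fin 5 →₀ ℕ} : m ∈ Δ ↔ ∑ i, m i = 5 := Iff.rfl

lemma mem_Q_iff {F : Poly} : F ∈ Q ↔ ∀ m, coeff m F ≠ 0 → m ∈ Δ := by
  simp only [Q, mem_homogeneousSubmodule, IsHomogeneous, IsWeightedHomogeneous, Δ,
    Set.mem_ofPred_eq]
  refine forall_congr' fun m => ?_
  simp [Finsupp.weight_apply, Finsupp.sum_fintype]

lemma subst_mem_Q {F : Poly} (hF : F ∈ Q) (A : Matrix (Fin 5) (Fin 5) ℂ) : subst A F ∈ Q := by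
  have h : ∀ j, (linForm A j).IsHomogeneous 1 := fun j =>
    IsHomogeneous.sum _ _ _ fun k _ => isHomogeneous_C_mul_X _ _
  have := IsHomogeneous.aeval (S := ℂ) hF (linForm A) h
  rwa [one_mul] at this

/-- The index type lists each variable with its multiplicity, so that a power product becomes a
plain product of linear forms to which the perturbation estimates apply. -/
lemma subst_monomial (A : Matrix (Fin 5) (Fin 5) ℂ) (m : Fin 5 →₀ ℕ) (c : ℂ) :
    subst A (monomial m c) = c • ∏ i : (Σ j, Fin (m j)), linForm A i.1 := by
  rw [subst_eq, bind₁_monomial, ← smul_eq_C_mul]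
  congr 1
  rw [Fintype.prod_sigma]
  simp only [Finset.prod_const, Finset.card_univ, Fintype.card_fin]
  exact Finset.prod_subset (Finset.subset_univ _) fun i _ hi => by
    rw [Finsupp.notMem_support_iff.mp hi, pow_zero]

lemma monomial_eq_prod (m : Fin 5 →₀ ℕ) (c : ℂ) :
    (monomial m c : Poly) = c • ∏ i : (Σ j, Fin (m j)), (X i.1 : Poly) := by
  conv_lhs => rw [← subst_one (monomial m c), subst_monomial]
  simp [linForm, Matrix.one_apply]

lemma card_sigma {m : Fin 5 →₀ ℕ} (hm : m ∈ Δ) :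
    (Finset.univ : Finset (Σ j, Fin (m j))).card = 5 := by
  rw [Finset.card_univ, Fintype.card_sigma]
  simpa using mem_Δ_iff.mp hm

lemma l1_subst_le {A : Matrix (Fin 5) (Fin 5) ℂ} {a : ℝ} (hA : ∀ j, ∑ k, ‖A j k‖ ≤ a)
    {F : Poly} (hF : F ∈ Q) : l1 (subst A F) ≤ a ^ 5 * l1 F := by
  conv_lhs => rw [F.as_sum, subst_sum]
  refine (l1_sum_le _ _).trans ?_
  rw [l1, Finset.mul_sum]
  refine Finset.sum_le_sum fun m hm => ?_
  rw [subst_monomial, l1_smul, mul_comm]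
  refine mul_le_mul_of_nonneg_right ?_ (norm_nonneg _)
  have h := l1_prod_le (x := fun i : (Σ j, Fin (m j)) => linForm A i.1) Finset.univ
    fun i _ => (l1_linForm_le _ _).trans (hA _)
  rwa [card_sigma (mem_Q_iff.mp hF m (mem_support_iff.mp hm))] at h

lemma l1_subst_sub_le {N : Matrix (Fin 5) (Fin 5) ℂ} {n : ℝ} (hN : ∀ j, ∑ k, ‖N j k‖ ≤ n)
    {F : Poly} (hF : F ∈ Q) : l1 (subst (1 + N) F - F) ≤ ((1 + n) ^ 5 - 1) * l1 F := by
  have : subst (1 + N) F - F = ∑ m ∈ F.support, (subst (1 + N) (monomial m (coeff m F)) -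
      monomial m (coeff m F)) := by
    rw [Finset.sum_sub_distrib, ← subst_sum, ← F.as_sum]
  rw [this]
  refine (l1_sum_le _ _).trans ?_
  rw [l1, Finset.mul_sum]
  refine Finset.sum_le_sum fun m hm => ?_
  rw [subst_monomial]
  conv_lhs => rw [monomial_eq_prod, ← smul_sub, l1_smul, mul_comm]
  refine mul_le_mul_of_nonneg_right ?_ (norm_nonneg _)
  have h := l1_prod_add_sub_prod_le (x := fun i : (Σ j, Fin (m j)) => X i.1)
    (fun i => (l1_X _).le) (fun i => (l1_linForm_le _ i.1).trans (hN _)) Finset.univ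
  rw [card_sigma (mem_Q_iff.mp hF m (mem_support_iff.mp hm))] at h
  simpa only [linForm_one_add] using h

lemma pInf_eq_monomial : pInf = monomial m₀ 1 := by
  rw [monomial_eq, C_1, one_mul, Finsupp.prod_fintype _ _ (fun i => pow_zero _)]
  simp [pInf, m₀]

lemma prod_erase_mul_X (j k : Fin 5) :
    (X k * ∏ i ∈ Finset.univ.erase j, X i : Poly) = monomial (mShift j k) 1 := by
  have h : ∏ i ∈ Finset.univ.erase j, (X i : Poly) = monomial (m₀ - Finsupp.single j 1) 1 := by
    rw [monomial_eq, C_1, one_mul, Finsupp.prod_fintype _ _ (fun i => pow_zero _),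
      ← Finset.mul_prod_erase _ _ (Finset.mem_univ j)]
    simp only [m₀, Finsupp.tsub_apply, Finsupp.equivFunOnFinite_symm_apply_apply,
      Finsupp.single_eq_same, tsub_self, pow_zero, one_mul]
    refine Finset.prod_congr rfl fun i hi => ?_
    rw [Finsupp.single_eq_of_ne (Finset.ne_of_mem_erase hi)]
    simp
  rw [h, X, monomial_mul, mul_one, mShift, add_comm]

/-- The derivative of the action at `p_∞`: replacing the factor `z_j` by `z_k` turns `z^{m₀}` into
`z^{m_jk}`, with `m_jj = m₀`. -/
lemma l1_subst_pInf_sub_le {N : Matrix (Fin 5) (Fin 5) ℂ} {n : ℝ}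
    (hN : ∀ j, ∑ k, ‖N j k‖ ≤ n) :
    l1 (subst (1 + N) pInf - pInf - ∑ j, ∑ k, monomial (mShift j k) (N j k)) ≤
      (1 + n) ^ 5 - 1 - 5 * n := by
  have h := l1_prod_add_second_order_le (fun i => (l1_X i).le)
    (fun i => (l1_linForm_le N i).trans (hN i)) Finset.univ
  have e : ∀ j, linForm N j * ∏ i ∈ Finset.univ.erase j, (X i : Poly) =
      ∑ k, monomial (mShift j k) (N j k) := fun j => by
    rw [linForm, Finset.sum_mul]
    refine Finset.sum_congr rfl fun k _ => ?_
    rw [mul_assoc, prod_erase_mul_X, C_mul_monomial, mul_one]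
  simp only [e, ← linForm_one_add, Finset.card_univ, Fintype.card_fin] at h
  rw [pInf, subst_prod]
  simp only [subst_X]
  exact_mod_cast h

/-! ### The exponents of quintics -/

lemma m₀_apply (i : Fin 5) : m₀ i = 1 := rfl

lemma mShift_apply {j k : Fin 5} (h : j ≠ k) (i : Fin 5) :
    mShift j k i = if i = j then 0 else if i = k then 2 else 1 := by
  simp only [mShift, Finsupp.add_apply, Finsupp.tsub_apply, m₀_apply, Finsupp.single_apply,
    eq_comm (a := j), eq_comm (a := k)]
  split_ifs with h1 h2 <;> simp_all

lemma mShift_self (j : Fin 5) : mShift j j = m₀ := by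
  ext i
  simp only [mShift, Finsupp.add_apply, Finsupp.tsub_apply, m₀_apply, Finsupp.single_apply]
  split_ifs <;> simp

lemma mShift_ne_m₀ {j k : Fin 5} (h : j ≠ k) : mShift j k ≠ m₀ := fun e => by
  have := DFunLike.congr_fun e j
  simp [mShift_apply h, m₀_apply] at this

lemma mShift_inj {j k j' k' : Fin 5} (h : j ≠ k) (h' : j' ≠ k')
    (e : mShift j k = mShift j' k') : j = j' ∧ k = k' := by
  have e1 := DFunLike.congr_fun e j
  have e2 := DFunLike.congr_fun e k
  simp only [mShift_apply h, mShift_apply h'] at e1 e2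
  split_ifs at e1 e2 <;> simp_all

lemma mem_Δ₀_iff {m : Fin 5 →₀ ℕ} :
    m ∈ Δ₀ ↔ m ∈ Δ ∧ ∃ i j, i ≠ j ∧ m i = 0 ∧ m j = 0 := Iff.rfl

lemma m₀_notMem_Δ₀ : m₀ ∉ Δ₀ := fun h => by
  obtain ⟨-, i, j, -, hi, -⟩ := mem_Δ₀_iff.mp h
  simp [m₀_apply] at hi

lemma mShift_notMem_Δ₀ {j k : Fin 5} (h : j ≠ k) : mShift j k ∉ Δ₀ := fun hm => by
  obtain ⟨-, a, b, hab, ha, hb⟩ := mem_Δ₀_iff.mp hm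
  rw [mShift_apply h] at ha hb
  split_ifs at ha hb
  simp_all

/-- With at most one zero among five entries of sum five, either all entries are one, or one entry
is zero and the other four are positive, so exactly one of them is two. -/
lemma mem_Δ_cases {m : Fin 5 →₀ ℕ} (hm : m ∈ Δ) :
    m = m₀ ∨ (∃ j k, j ≠ k ∧ m = mShift j k) ∨ m ∈ Δ₀ := by
  by_cases h0 : m ∈ Δ₀
  · exact Or.inr (Or.inr h0)
  have hs : ∀ i j, i ≠ j → m i = 0 → m j ≠ 0 := fun i j hij hi hj =>
    h0 (mem_Δ₀_iff.mpr ⟨hm, i, j, hij, hi, hj⟩)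
  have hsum := mem_Δ_iff.mp hm
  by_cases hz : ∃ j, m j = 0
  · obtain ⟨j, hj⟩ := hz
    have hpos : ∀ i ∈ Finset.univ.erase j, 1 ≤ m i := fun i hi =>
      Nat.one_le_iff_ne_zero.mpr (hs j i (Finset.ne_of_mem_erase hi).symm hj)
    have hcard : (Finset.univ.erase j).card = 4 := by simp
    rw [← Finset.add_sum_erase _ _ (Finset.mem_univ j), hj, zero_add] at hsum
    obtain ⟨k, hk, hk2⟩ : ∃ k ∈ Finset.univ.erase j, 1 < m k := by
      by_contra! hcon
      have := Finset.sum_le_card_nsmul _ _ 1 hcon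
      simp only [hcard, smul_eq_mul, mul_one] at this
      have h' := hsum
      change (Finset.univ.erase j).sum m = 5 at h'
      omega
    have hcard' : ((Finset.univ.erase j).erase k).card = 3 := by
      rw [Finset.card_erase_of_mem hk, hcard]
    rw [← Finset.add_sum_erase _ _ hk] at hsum
    refine Or.inr (Or.inl ⟨j, k, (Finset.ne_of_mem_erase hk).symm, ?_⟩)
    ext i
    rw [mShift_apply (Finset.ne_of_mem_erase hk).symm]
    have hlow : ∀ s ⊆ Finset.univ.erase j, s.card ≤ ∑ i ∈ s, m i := fun s hs' => by
      have := Finset.card_nsmul_le_sum s m 1 fun i hi => hpos i (hs' hi)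
      simpa using this
    have h3 := hlow _ (Finset.erase_subset k _)
    rw [hcard'] at h3
    split_ifs with h1 h2
    · rw [h1, hj]
    · rw [h2]; omega
    · have hi : i ∈ (Finset.univ.erase j).erase k := by simp [h1, h2]
      have h4 := hlow _ ((Finset.erase_subset i _).trans (Finset.erase_subset k _))
      rw [Finset.card_erase_of_mem hi, hcard'] at h4
      rw [← Finset.add_sum_erase _ _ hi] at hsum
      have := hpos i (Finset.mem_of_mem_erase hi)
      omega
  · push Not at hz
    refine Or.inl ?_
    ext i
    rw [m₀_apply]
    have hlow := Finset.card_nsmul_le_sum (Finset.univ.erase i) m 1 fun i _ =>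
      Nat.one_le_iff_ne_zero.mpr (hz i)
    simp only [Finset.mem_univ, Finset.card_erase_of_mem, Finset.card_univ, Fintype.card_fin,
      smul_eq_mul, mul_one] at hlow
    rw [← Finset.add_sum_erase _ _ (Finset.mem_univ i)] at hsum
    change m i + (Finset.univ.erase i).sum m = 5 at hsum
    have := hz i
    omega

/-- The finite set of the exponents of degree five. -/
def degFive : Finset (Fin 5 →₀ ℕ) := Finset.univ.finsuppAntidiag 5

lemma mem_degFive {m : Fin 5 →₀ ℕ} : m ∈ degFive ↔ m ∈ Δ := by
  simp [degFive, mem_Δ_iff]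

lemma m₀_mem_Δ : m₀ ∈ Δ := by simp [mem_Δ_iff, m₀_apply]

lemma support_subset_degFive {F : Poly} (hF : F ∈ Q) : F.support ⊆ degFive := fun m hm =>
  mem_degFive.mpr (mem_Q_iff.mp hF m (mem_support_iff.mp hm))

lemma coeff_eq_zero_of_mem_Q {F : Poly} (hF : F ∈ Q) {m : Fin 5 →₀ ℕ} (hm : m ∉ Δ) :
    coeff m F = 0 := by
  by_contra h
  exact hm (mem_Q_iff.mp hF m h)

open Classical in
/-- The finite set of the exponents in `Δ⁰`. -/
def skeleton : Finset (Fin 5 →₀ ℕ) := degFive.filter (· ∈ Δ₀)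

lemma mem_skeleton {m : Fin 5 →₀ ℕ} : m ∈ skeleton ↔ m ∈ Δ₀ := by
  classical
  rw [skeleton, Finset.mem_filter, mem_degFive]
  exact ⟨fun h => h.2, fun h => ⟨h.1, h⟩⟩

/-- The finite set of the exponents `m_{jk}`, `j ≠ k`. -/
def shifts : Finset (Fin 5 →₀ ℕ) :=
  (Finset.univ : Finset (Fin 5)).offDiag.image fun p => mShift p.1 p.2

lemma mem_shifts {m : Fin 5 →₀ ℕ} : m ∈ shifts ↔ ∃ j k, j ≠ k ∧ m = mShift j k := by
  simp only [shifts, Finset.mem_image, Finset.mem_offDiag, Prod.exists, Finset.mem_univ, true_and]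
  exact exists₂_congr fun j k => and_congr_right fun _ => eq_comm

lemma mShift_mem_shifts {j k : Fin 5} (h : j ≠ k) : mShift j k ∈ shifts :=
  mem_shifts.mpr ⟨j, k, h, rfl⟩

lemma sum_shifts {M : Type*} [AddCommMonoid M] (f : (Fin 5 →₀ ℕ) → M) :
    ∑ m ∈ shifts, f m = ∑ j, ∑ k, if j = k then 0 else f (mShift j k) := by
  rw [shifts, Finset.sum_image, ← Finset.sum_product', Finset.univ_product_univ]
  · have h : (Finset.univ : Finset (Fin 5)).offDiag =
        Finset.univ.filter fun p : Fin 5 × Fin 5 => ¬ p.1 = p.2 := by ext; simp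
    rw [h, Finset.sum_filter]
    exact Finset.sum_congr rfl fun p _ => by rw [ite_not]
  · intro p hp q hq h
    have hp' : p.1 ≠ p.2 := by simpa using hp
    have hq' : q.1 ≠ q.2 := by simpa using hq
    exact Prod.ext_iff.mpr (mShift_inj hp' hq' h)

lemma mShift_mem_Δ (j k : Fin 5) : mShift j k ∈ Δ := by
  rw [mem_Δ_iff]
  by_cases h : j = k
  · subst h
    rw [mShift_self]
    exact m₀_mem_Δ
  · have e : m₀ = (m₀ - Finsupp.single j 1) + Finsupp.single j 1 := by
      ext i
      simp only [Finsupp.add_apply, Finsupp.tsub_apply, m₀_apply, Finsupp.single_apply]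
      split_ifs <;> simp
    have h2 : ∑ i, m₀ i = 5 := m₀_mem_Δ
    rw [e] at h2
    simp only [mShift, Finsupp.add_apply, Finset.sum_add_distrib] at h2 ⊢
    simpa [Finsupp.single_apply] using h2

lemma sum_degFive {M : Type*} [AddCommMonoid M] (f : (Fin 5 →₀ ℕ) → M) :
    ∑ m ∈ degFive, f m = f m₀ + ∑ m ∈ shifts, f m + ∑ m ∈ skeleton, f m := by
  classical
  have h1 : m₀ ∉ shifts := fun h => by
    obtain ⟨j, k, hjk, e⟩ := mem_shifts.mp h
    exact mShift_ne_m₀ hjk e.symm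
  have h2 : Disjoint (insert m₀ shifts) skeleton := by
    rw [Finset.disjoint_left]
    intro m hm hm'
    rw [mem_skeleton] at hm'
    rcases Finset.mem_insert.mp hm with rfl | h
    · exact m₀_notMem_Δ₀ hm'
    · obtain ⟨j, k, hjk, rfl⟩ := mem_shifts.mp h
      exact mShift_notMem_Δ₀ hjk hm'
  have h3 : degFive = insert m₀ shifts ∪ skeleton := by
    ext m
    simp only [mem_degFive, Finset.mem_union, Finset.mem_insert, mem_skeleton, mem_shifts]
    constructor
    · intro hm
      rw [or_assoc]
      exact mem_Δ_cases hm
    · rintro ((rfl | ⟨j, k, -, rfl⟩) | h)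
      · exact m₀_mem_Δ
      · exact mShift_mem_Δ j k
      · exact h.1
  rw [h3, Finset.sum_union h2, Finset.sum_insert h1]

/-! ### Decomposition of a quintic -/

/-- The part of a polynomial with exponents in a finite set. -/
def part (s : Finset (Fin 5 →₀ ℕ)) (F : Poly) : Poly := ∑ m ∈ s, monomial m (coeff m F)

open Classical in
lemma coeff_part (s : Finset (Fin 5 →₀ ℕ)) (F : Poly) (m : Fin 5 →₀ ℕ) :
    coeff m (part s F) = if m ∈ s then coeff m F else 0 := by
  simp [part, coeff_sum, coeff_monomial]

lemma support_part_subset (s : Finset (Fin 5 →₀ ℕ)) (F : Poly) : (part s F).support ⊆ s :=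
  fun m hm => by
    classical
    rw [mem_support_iff, coeff_part] at hm
    by_contra h
    exact hm (if_neg h)

lemma l1_part (s : Finset (Fin 5 →₀ ℕ)) (F : Poly) : l1 (part s F) = ∑ m ∈ s, ‖coeff m F‖ := by
  classical
  rw [l1_eq_sum (support_part_subset s F)]
  exact Finset.sum_congr rfl fun m hm => by rw [coeff_part, if_pos hm]

lemma part_add (s : Finset (Fin 5 →₀ ℕ)) (F G : Poly) : part s (F + G) = part s F + part s G := by
  simp [part, Finset.sum_add_distrib]

lemma part_smul (s : Finset (Fin 5 →₀ ℕ)) (c : ℂ) (F : Poly) : part s (c • F) = c • part s F := by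
  simp [part, Finset.smul_sum, smul_monomial]

lemma part_mem_Q {F : Poly} (hF : F ∈ Q) (s : Finset (Fin 5 →₀ ℕ)) : part s F ∈ Q := by
  classical
  refine mem_Q_iff.mpr fun m hm => mem_Q_iff.mp hF m ?_
  rw [coeff_part] at hm
  exact fun h => hm (by simp [h])

lemma l1_of_mem_Q {F : Poly} (hF : F ∈ Q) :
    l1 F = ‖coeff m₀ F‖ + l1 (part shifts F) + l1 (part skeleton F) := by
  rw [l1_eq_sum (support_subset_degFive hF), sum_degFive, l1_part, l1_part]

lemma eq_sum_parts {F : Poly} (hF : F ∈ Q) :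
    F = coeff m₀ F • pInf + part shifts F + part skeleton F := by
  have h : F = ∑ m ∈ degFive, monomial m (coeff m F) := by
    conv_lhs => rw [F.as_sum]
    exact Finset.sum_subset (support_subset_degFive hF) fun m _ hm => by
      rw [notMem_support_iff.mp hm, monomial_zero]
  conv_lhs => rw [h, sum_degFive]
  rw [pInf_eq_monomial, smul_monomial, smul_eq_mul, mul_one, part, part]

lemma part_shifts (F : Poly) : part shifts F =
    ∑ j, ∑ k, monomial (mShift j k) (if j = k then 0 else coeff (mShift j k) F) := by
  rw [part, sum_shifts]
  refine Finset.sum_congr rfl fun j _ => Finset.sum_congr rfl fun k _ => ?_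
  split_ifs <;> simp

lemma l1_part_shifts (F : Poly) : l1 (part shifts F) =
    ∑ j, ∑ k, ‖if j = k then 0 else coeff (mShift j k) F‖ := by
  rw [l1_part, sum_shifts]
  refine Finset.sum_congr rfl fun j _ => Finset.sum_congr rfl fun k _ => ?_
  split_ifs <;> simp

lemma l1_le_of_coeff_le {F : Poly} (hF : F ∈ Q) {c : ℝ} (h : ∀ m, ‖coeff m F‖ ≤ c) :
    l1 F ≤ degFive.card * c := by
  rw [l1_eq_sum (support_subset_degFive hF)]
  simpa using Finset.sum_le_card_nsmul degFive _ c fun m _ => h m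

lemma l1_part_le_of_coeff_le {F : Poly} (hF : F ∈ Q) {c : ℝ} (hc : 0 ≤ c)
    {s : Finset (Fin 5 →₀ ℕ)} (h : ∀ m ∈ s, ‖coeff m F‖ ≤ c) :
    l1 (part s F) ≤ degFive.card * c := by
  classical
  refine l1_le_of_coeff_le (part_mem_Q hF s) fun m => ?_
  rw [coeff_part]
  split_ifs with hm
  · exact h m hm
  · simpa using hc

/-! ### The slice `Q₀` -/

lemma mem_spanΔ₀_iff {F : Poly} : F ∈ spanΔ₀ ↔ ∀ m, coeff m F ≠ 0 → m ∈ Δ₀ := by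
  classical
  constructor
  · intro hF
    refine Submodule.span_induction (p := fun F _ => ∀ m, coeff m F ≠ 0 → m ∈ Δ₀)
      ?_ ?_ ?_ ?_ hF
    · rintro _ ⟨m', hm', rfl⟩ m hm
      rw [coeff_monomial] at hm
      by_cases e : m' = m
      · exact e ▸ hm'
      · exact absurd (if_neg e) hm
    · simp
    · intro F G _ _ hF hG m hm
      rw [coeff_add] at hm
      by_cases h : coeff m F = 0
      · exact hG m fun h' => hm (by rw [h, h', add_zero])
      · exact hF m h
    · intro c F _ hF m hm
      rw [coeff_smul] at hm
      exact hF m (right_ne_zero_of_mul hm)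
  · intro h
    rw [F.as_sum]
    refine Submodule.sum_mem _ fun m hm => ?_
    rw [← mul_one (coeff m F), ← smul_eq_mul, ← smul_monomial]
    exact Submodule.smul_mem _ _ (Submodule.subset_span ⟨m, h m (mem_support_iff.mp hm), rfl⟩)

lemma mem_Q₀_iff_sub {q : Poly} : q ∈ Q₀ ↔ q - pInf ∈ spanΔ₀ := AffineSubspace.mem_mk'

lemma coeff_pInf (m : Fin 5 →₀ ℕ) : coeff m pInf = if m₀ = m then 1 else 0 := by
  rw [pInf_eq_monomial, coeff_monomial]

lemma pInf_mem_Q : pInf ∈ Q := mem_Q_iff.mpr fun m hm => by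
  rw [coeff_pInf] at hm
  by_cases h : m₀ = m
  · exact h ▸ m₀_mem_Δ
  · exact absurd (if_neg h) hm

lemma mem_Q₀_iff {q : Poly} : q ∈ Q₀ ↔
    q ∈ Q ∧ coeff m₀ q = 1 ∧ ∀ j k, j ≠ k → coeff (mShift j k) q = 0 := by
  rw [mem_Q₀_iff_sub, mem_spanΔ₀_iff]
  constructor
  · intro h
    refine ⟨?_, ?_, fun j k hjk => ?_⟩
    · have : q - pInf ∈ Q := mem_Q_iff.mpr fun m hm => (h m hm).1
      simpa using Q.add_mem this pInf_mem_Q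
    · by_contra hne
      exact m₀_notMem_Δ₀ (h m₀ (by rwa [coeff_sub, coeff_pInf, if_pos rfl, sub_ne_zero]))
    · by_contra hne
      refine mShift_notMem_Δ₀ hjk (h _ ?_)
      rwa [coeff_sub, coeff_pInf, if_neg (mShift_ne_m₀ hjk).symm, sub_zero]
  · rintro ⟨hQ, h0, hB⟩ m hm
    rcases mem_Δ_cases (mem_Q_iff.mp (Q.sub_mem hQ pInf_mem_Q) m hm) with rfl | ⟨j, k, hjk, rfl⟩ | h
    · simp [coeff_pInf, h0] at hm
    · simp [coeff_pInf, hB j k hjk, (mShift_ne_m₀ hjk).symm] at hm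
    · exact h

lemma pInf_mem_Q₀ : pInf ∈ Q₀ := by
  rw [mem_Q₀_iff_sub, sub_self]
  exact Submodule.zero_mem _

/-! ### Diagonal matrices, permutations and scalars -/

lemma coeff_subst_diagonal (t : Fin 5 → ℂ) (F : Poly) (m : Fin 5 →₀ ℕ) :
    coeff m (subst (diagonal t) F) = (∏ i, t i ^ m i) * coeff m F := by
  classical
  have hl : linForm (diagonal t) = fun j => C (t j) * X j := by
    ext1 j
    simp only [linForm, diagonal_apply, apply_ite, map_zero, ite_mul, zero_mul,
      Finset.sum_ite_eq, Finset.mem_univ, if_true]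
  induction F using MvPolynomial.induction_on' with
  | monomial m' c =>
    have : subst (diagonal t) (monomial m' c) = C (∏ i, t i ^ m' i) * monomial m' c := by
      rw [subst_eq, bind₁_monomial, hl, monomial_eq, Finsupp.prod_fintype _ _ fun i => pow_zero _]
      have h2 : ∏ i ∈ m'.support, (C (t i) * X i : Poly) ^ m' i =
          ∏ i, (C (t i) * X i : Poly) ^ m' i :=
        Finset.prod_subset (Finset.subset_univ _) fun i _ hi => by
          rw [Finsupp.notMem_support_iff.mp hi, pow_zero]
      rw [h2]
      simp only [mul_pow, Finset.prod_mul_distrib, map_prod, map_pow]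
      ring
    rw [this, coeff_C_mul]
    by_cases h : m' = m
    · rw [h]
    · simp [coeff_monomial, h]
  | add F G hF hG => rw [subst_add, coeff_add, hF, hG, coeff_add, mul_add]

lemma subst_smul_one (c : ℂ) {F : Poly} (hF : F ∈ Q) :
    subst (c • (1 : Matrix (Fin 5) (Fin 5) ℂ)) F = c ^ 5 • F := by
  ext m
  rw [smul_one_eq_diagonal, coeff_subst_diagonal, coeff_smul, smul_eq_mul]
  by_cases hm : m ∈ Δ
  · rw [Finset.prod_pow_eq_pow_sum, mem_Δ_iff.mp hm]
  · rw [coeff_eq_zero_of_mem_Q hF hm, mul_zero, mul_zero]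

lemma subst_permMatrix (σ : Equiv.Perm (Fin 5)) (F : Poly) :
    subst (σ.permMatrix ℂ) F = rename σ F := by
  have h : bind₁ (linForm (σ.permMatrix ℂ)) = rename σ := by
    refine algHom_ext fun j => ?_
    rw [bind₁_X_right, rename_X]
    simp [linForm]
  rw [subst_eq, h]

lemma coeff_rename_perm (σ : Equiv.Perm (Fin 5)) (F : Poly) (m : Fin 5 →₀ ℕ) :
    coeff m (rename σ F) = coeff (m.mapDomain ⇑σ⁻¹) F := by
  conv_rhs => rw [← coeff_rename_mapDomain σ σ.injective F]
  have h : σ ∘ ⇑σ⁻¹ = id := funext fun i => σ.apply_symm_apply i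
  rw [← Finsupp.mapDomain_comp, h, Finsupp.mapDomain_id]

lemma mapDomain_perm_apply (σ : Equiv.Perm (Fin 5)) (m : Fin 5 →₀ ℕ) (i : Fin 5) :
    m.mapDomain σ i = m (σ⁻¹ i) := by
  conv_lhs => rw [← σ.apply_symm_apply i]
  rw [Finsupp.mapDomain_apply σ.injective]
  rfl

lemma rename_pInf (σ : Equiv.Perm (Fin 5)) : rename σ pInf = pInf := by
  rw [pInf, map_prod]
  simp only [rename_X]
  exact Equiv.prod_comp σ (fun i => (X i : Poly))

lemma mapDomain_mem_Δ₀ (σ : Equiv.Perm (Fin 5)) {m : Fin 5 →₀ ℕ}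
    (hm : m.mapDomain ⇑σ⁻¹ ∈ Δ₀) : m ∈ Δ₀ := by
  obtain ⟨hs, i, j, hij, hi, hj⟩ := mem_Δ₀_iff.mp hm
  simp only [mapDomain_perm_apply, inv_inv, mem_Δ_iff] at hs hi hj
  refine mem_Δ₀_iff.mpr ⟨?_, σ i, σ j, σ.injective.ne hij, hi, hj⟩
  rw [mem_Δ_iff]
  exact (Equiv.sum_comp σ m).symm.trans hs

lemma rename_mem_Q₀ (σ : Equiv.Perm (Fin 5)) {q : Poly} (hq : q ∈ Q₀) : rename σ q ∈ Q₀ := by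
  rw [mem_Q₀_iff_sub, mem_spanΔ₀_iff] at hq ⊢
  intro m hm
  rw [← rename_pInf σ, ← map_sub, coeff_rename_perm] at hm
  exact mapDomain_mem_Δ₀ σ (hq _ hm)

lemma near_rename (σ : Equiv.Perm (Fin 5)) {ε : ℝ} {q : Poly} (hq : Near ε q pInf) :
    Near ε (rename σ q) pInf := fun m => by
  rw [← rename_pInf σ, coeff_rename_perm, coeff_rename_perm]
  exact hq _

lemma subst_diagonal_mem_Q₀ {t : Fin 5 → ℂ} (ht : ∏ i, t i = 1) {q : Poly} (hq : q ∈ Q₀) :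
    subst (diagonal t) q ∈ Q₀ := by
  rw [mem_Q₀_iff] at hq ⊢
  obtain ⟨hQ, h0, hB⟩ := hq
  refine ⟨subst_mem_Q hQ _, ?_, fun j k hjk => ?_⟩
  · simp [coeff_subst_diagonal, h0, m₀_apply, ht]
  · simp [coeff_subst_diagonal, hB j k hjk]

/-- The diagonal of an element of the torus has product one. -/
lemma exists_diagonal_of_mem_torus {t : SpecialLinearGroup (Fin 5) ℂ} (ht : t ∈ torus) :
    ∃ d : Fin 5 → ℂ, (t : Matrix (Fin 5) (Fin 5) ℂ) = diagonal d ∧ ∏ i, d i = 1 := by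
  obtain ⟨d, hd⟩ := ht
  refine ⟨d, hd, ?_⟩
  rw [← det_diagonal, ← hd, t.det_coe]

lemma exists_torus_eq_diagonal {d : Fin 5 → ℂ} (hd : ∏ i, d i = 1) :
    ∃ t ∈ torus, (t : Matrix (Fin 5) (Fin 5) ℂ) = diagonal d :=
  ⟨⟨diagonal d, by rw [det_diagonal, hd]⟩, ⟨d, rfl⟩, rfl⟩

lemma subst_torus_mem_Q₀ {t : SpecialLinearGroup (Fin 5) ℂ} (ht : t ∈ torus) {q : Poly}
    (hq : q ∈ Q₀) : subst (t : Matrix (Fin 5) (Fin 5) ℂ) q ∈ Q₀ := by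
  obtain ⟨d, hd, hp⟩ := exists_diagonal_of_mem_torus ht
  rw [hd]
  exact subst_diagonal_mem_Q₀ hp hq

/-! ### One step of the iteration -/

/-- The matrix `B` of the coefficients of `z^{m_{jk}}`, `j ≠ k`. -/
def shiftMatrix (F : Poly) : Matrix (Fin 5) (Fin 5) ℂ :=
  Matrix.of fun j k => if j = k then 0 else coeff (mShift j k) F

lemma step_eq (F : Poly) : step F = 1 + -((coeff m₀ F)⁻¹ • shiftMatrix F) := sub_eq_add_neg _ _

lemma row_sum_step_le (F : Poly) (j : Fin 5) :
    ∑ k, ‖(-((coeff m₀ F)⁻¹ • shiftMatrix F)) j k‖ ≤ ‖coeff m₀ F‖⁻¹ * l1 (part shifts F) := by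
  have h : ∑ k, ‖(-((coeff m₀ F)⁻¹ • shiftMatrix F)) j k‖ =
      ‖coeff m₀ F‖⁻¹ * ∑ k, ‖shiftMatrix F j k‖ := by
    rw [Finset.mul_sum]
    exact Finset.sum_congr rfl fun k _ => by simp
  rw [h, l1_part_shifts]
  exact mul_le_mul_of_nonneg_left
    (Finset.single_le_sum (f := fun j => ∑ k, ‖if j = k then 0 else coeff (mShift j k) F‖)
      (fun j _ => Finset.sum_nonneg fun _ _ => norm_nonneg _) (Finset.mem_univ j))
    (by positivity)

/-- A step of the iteration removes the coefficients of `z^{m_{jk}}` up to second order. -/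
lemma l1_subst_step_le {F : Poly} (hF : F ∈ Q) (h0 : coeff m₀ F ≠ 0) {n : ℝ}
    (hn : ‖coeff m₀ F‖⁻¹ * l1 (part shifts F) = n) (hn1 : n ≤ 1) :
    l1 (subst (step F) F - coeff m₀ F • pInf - part skeleton F) ≤
      n * (57 * l1 (part shifts F) + 31 * l1 (part skeleton F)) := by
  set ψ := coeff m₀ F
  set b := part shifts F with hb
  set r := part skeleton F with hr
  set N := -(ψ⁻¹ • shiftMatrix F) with hN
  have hψ : 0 < ‖ψ‖ := norm_pos_iff.mpr h0
  have hn0 : 0 ≤ n := by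
    rw [← hn]
    exact mul_nonneg (by positivity) (l1_nonneg _)
  have hβ : l1 b = ‖ψ‖ * n := by
    rw [← hn]
    field_simp
  have hrow : ∀ j, ∑ k, ‖N j k‖ ≤ n := fun j => (row_sum_step_le F j).trans hn.le
  have hlin : ∑ j, ∑ k, monomial (mShift j k) (N j k) = -(ψ⁻¹ • b) := by
    rw [hb, part_shifts, Finset.smul_sum, ← Finset.sum_neg_distrib]
    refine Finset.sum_congr rfl fun j _ => ?_
    rw [Finset.smul_sum, ← Finset.sum_neg_distrib]
    refine Finset.sum_congr rfl fun k _ => ?_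
    rw [smul_monomial, ← map_neg]
    rfl
  -- The linear term coming from `ψ p_∞` is exactly `-b`, so it cancels `b`. The error is a
  -- second-order term of `p_∞` and first-order terms of the small parts `b` and `r`.
  have e : subst (step F) F - ψ • pInf - r =
      ψ • (subst (1 + N) pInf - pInf - ∑ j, ∑ k, monomial (mShift j k) (N j k)) +
        (subst (1 + N) b - b) + (subst (1 + N) r - r) := by
    rw [hlin, step_eq]
    have h := congrArg (subst (1 + N)) (eq_sum_parts hF)
    rw [subst_add, subst_add, subst_smul] at h
    rw [h, smul_sub, smul_sub, smul_neg, smul_smul,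
      mul_inv_cancel₀ h0, one_smul]
    abel
  rw [e]
  have h1 := l1_subst_pInf_sub_le hrow
  have h2 := l1_subst_sub_le hrow (part_mem_Q hF shifts)
  have h3 := l1_subst_sub_le hrow (part_mem_Q hF skeleton)
  rw [← hb] at h2
  rw [← hr] at h3
  -- For `n ≤ 1` the binomial coefficients add up: `10 + 10 + 5 + 1 = 26` here and `5 + 26 = 31` in
  -- `p2`; then `57 = 26 + 31`.
  have p1 : (1 + n) ^ 5 - 1 - 5 * n ≤ 26 * (n * n) := by
    nlinarith [mul_nonneg hn0 (sub_nonneg.mpr hn1), mul_nonneg (mul_nonneg hn0 hn0)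
      (sub_nonneg.mpr hn1), mul_nonneg (mul_nonneg (mul_nonneg hn0 hn0) hn0) (sub_nonneg.mpr hn1)]
  have p2 : (1 + n) ^ 5 - 1 ≤ 31 * n := by nlinarith
  have h1' := h1.trans p1
  have h2' := h2.trans (mul_le_mul_of_nonneg_right p2 (l1_nonneg b))
  have h3' := h3.trans (mul_le_mul_of_nonneg_right p2 (l1_nonneg r))
  refine (l1_add_le _ _).trans ((add_le_add (l1_add_le _ _) le_rfl).trans ?_)
  rw [l1_smul]
  have h1'' := mul_le_mul_of_nonneg_left h1' hψ.le
  have e2 : ‖ψ‖ * (26 * (n * n)) = n * (26 * l1 b) := by rw [hβ]; ring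
  linarith

/-! ### The iteration -/

/-- The step depends only on ratios of coefficients; this reduces the iteration to quintics with `ψ
= 1`. -/
lemma step_smul {c : ℂ} (hc : c ≠ 0) (F : Poly) : step (c • F) = step F := by
  ext i j
  simp only [step, coeff_smul, smul_eq_mul, Matrix.sub_apply, Matrix.smul_apply, Matrix.of_apply]
  split_ifs
  · simp
  · rw [mul_inv, mul_mul_mul_comm, inv_mul_cancel₀ hc, one_mul]

lemma iter_smul {c : ℂ} (hc : c ≠ 0) (F : Poly) (l : ℕ) : iter (c • F) l = c • iter F l := by
  induction l with
  | zero => rfl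
  | succ l ih => rw [iter, iter, ih, step_smul hc, subst_smul]

lemma partialProd_smul {c : ℂ} (hc : c ≠ 0) (F : Poly) (l : ℕ) :
    partialProd (c • F) l = partialProd F l := by
  induction l with
  | zero => rfl
  | succ l ih => rw [partialProd, partialProd, ih, iter_smul hc, step_smul hc]

lemma iter_eq_subst (F : Poly) (l : ℕ) : iter F l = subst (partialProd F l) F := by
  induction l with
  | zero => exact (subst_one F).symm
  | succ l ih => rw [iter, partialProd, ← subst_subst, ← ih]

lemma continuous_coeff_subst (F : Poly) (m : Fin 5 →₀ ℕ) :
    Continuous fun A : Matrix (Fin 5) (Fin 5) ℂ => coeff m (subst A F) := by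
  classical
  induction F using MvPolynomial.induction_on generalizing m with
  | C c => simp only [subst_C]; exact continuous_const
  | add F G hF hG =>
    simp only [subst_add, coeff_add]
    exact (hF m).add (hG m)
  | mul_X F j hF =>
    have h : ∀ (A : Matrix (Fin 5) (Fin 5) ℂ) m', coeff m' (linForm A j) =
        ∑ k, A j k * coeff m' (X k) := fun A m' => by simp only [linForm, coeff_sum, coeff_C_mul]
    simp only [subst_mul, coeff_mul, subst_X, h]
    refine continuous_finsetSum _ fun p _ => (hF p.1).mul ?_
    exact continuous_finsetSum _ fun k _ => (continuous_apply_apply j k).mul continuous_const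

/-- Estimates along the iteration for a quintic with `ψ = 1`. -/
lemma iter_bounds {F : Poly} (hF : F ∈ Q) (hψ : coeff m₀ F = 1) {β θ : ℝ} (hβθ : β ≤ θ)
    (hθ : 480 * θ ≤ 1) (hβ : l1 (part shifts F) ≤ β) (hρ : l1 (part skeleton F) ≤ θ) (l : ℕ) :
    iter F l ∈ Q ∧ ‖coeff m₀ (iter F l) - 1‖ ≤ β * (1 - (1 / 2) ^ l) ∧
      l1 (part shifts (iter F l)) ≤ β * (240 * θ) ^ l ∧
      l1 (part skeleton (iter F l)) ≤ θ + β * (1 - (1 / 2) ^ l) ∧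
      l1 (iter F l - F) ≤ 4 * β * (1 - (1 / 2) ^ l) := by
  have hβ0 : 0 ≤ β := (l1_nonneg _).trans hβ
  have hθ0 : 0 ≤ θ := hβ0.trans hβθ
  have hκ : ∀ l : ℕ, (240 * θ) ^ l ≤ (1 / 2) ^ l := fun l =>
    pow_le_pow_left₀ (by positivity) (by linarith) l
  have hhalf : ∀ l : ℕ, (0 : ℝ) < (1 / 2) ^ l ∧ ((1 : ℝ) / 2) ^ l ≤ 1 := fun l =>
    ⟨by positivity, pow_le_one₀ (by norm_num) (by norm_num)⟩
  induction l with
  | zero => simpa [iter, hψ] using ⟨hF, hβ, hρ⟩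
  | succ l ih =>
    obtain ⟨hQ, h1, h2, h3, h4⟩ := ih
    set G := iter F l with hG
    set H := iter F (l + 1) with hH
    set x : ℝ := (1 / 2) ^ l with hx
    obtain ⟨hx0, hx1⟩ := hhalf l
    have hx' : ((1 : ℝ) / 2) ^ (l + 1) = x / 2 := by rw [pow_succ]; ring
    have h1b : ‖coeff m₀ G - 1‖ ≤ 1 / 2 := by nlinarith
    have hψ2 : 1 / 2 ≤ ‖coeff m₀ G‖ := by
      have := norm_sub_norm_le (1 : ℂ) (coeff m₀ G)
      rw [norm_one, norm_sub_rev] at this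
      linarith
    have hψinv : ‖coeff m₀ G‖⁻¹ ≤ 2 := by
      rw [inv_le_comm₀ (by linarith) (by norm_num)]
      linarith
    have hbx : l1 (part shifts G) ≤ β * x := h2.trans (mul_le_mul_of_nonneg_left (hκ l) hβ0)
    have hb0 := l1_nonneg (part shifts G)
    have hbθ : l1 (part shifts G) ≤ θ := by nlinarith
    have hrθ : l1 (part skeleton G) ≤ 2 * θ := by nlinarith
    have hn : ‖coeff m₀ G‖⁻¹ * l1 (part shifts G) ≤ 2 * l1 (part shifts G) :=
      mul_le_mul_of_nonneg_right hψinv hb0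
    have hE := l1_subst_step_le hQ (norm_pos_iff.mp (by linarith)) rfl (by linarith)
    have hHs : H = subst (step G) G := rfl
    rw [← hHs] at hE
    set E := H - coeff m₀ G • pInf - part skeleton G with hEdef
    -- The relative size is at most twice `l1 (part shifts G)`, and `57 θ + 31 · 2θ = 119 θ`;
    -- doubling gives `238 ≤ 240`. The convergence proved is linear, since the skeleton part enters
    -- the error and need not shrink.
    have hE' : l1 E ≤ 240 * θ * l1 (part shifts G) := by
      have hr0 := l1_nonneg (part skeleton G)
      have h119 : 57 * l1 (part shifts G) + 31 * l1 (part skeleton G) ≤ 119 * θ := by linarith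
      refine hE.trans ((mul_le_mul hn h119 (by linarith) (by linarith)).trans ?_)
      nlinarith
    have hEκ : l1 E ≤ β * (240 * θ) ^ (l + 1) := by
      refine hE'.trans ?_
      rw [pow_succ']
      have := mul_le_mul_of_nonneg_left h2 (show 0 ≤ 240 * θ by positivity)
      linarith
    have hEx : l1 E ≤ β * (x / 2) := by
      rw [← hx']
      exact hEκ.trans (mul_le_mul_of_nonneg_left (hκ _) hβ0)
    have hHQ : H ∈ Q := subst_mem_Q hQ _
    have hEQ : E ∈ Q := Q.sub_mem (Q.sub_mem hHQ (Q.smul_mem _ pInf_mem_Q)) (part_mem_Q hQ _)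
    have hEsum := l1_of_mem_Q hEQ
    have hHE : H = coeff m₀ G • pInf + part skeleton G + E := by rw [hEdef]; abel
    have hsplit := eq_sum_parts hQ
    have c0 : coeff m₀ (part skeleton G) = 0 := by
      classical
      rw [coeff_part, if_neg fun h => m₀_notMem_Δ₀ (mem_skeleton.mp h)]
    have e0 : coeff m₀ H = coeff m₀ G + coeff m₀ E := by
      rw [hHE, coeff_add, coeff_add, coeff_smul, coeff_pInf, if_pos rfl, c0, smul_eq_mul, mul_one,
        add_zero]
    have hcS : ∀ m ∈ shifts, coeff m (coeff m₀ G • pInf + part skeleton G) = 0 := fun m hm => by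
      classical
      obtain ⟨j, k, hjk, rfl⟩ := mem_shifts.mp hm
      rw [coeff_add, coeff_smul, coeff_pInf, if_neg (mShift_ne_m₀ hjk).symm, coeff_part,
        if_neg fun h => mShift_notMem_Δ₀ hjk (mem_skeleton.mp h), smul_zero, add_zero]
    have eS : part shifts H = part shifts E := by
      rw [hHE, part_add, add_eq_right]
      exact Finset.sum_eq_zero fun m hm => by rw [hcS m hm, monomial_zero]
    have hcK : ∀ m ∈ skeleton, coeff m (coeff m₀ G • pInf + part skeleton G) = coeff m G :=
        fun m hm => by
      classical
      rw [coeff_add, coeff_smul, coeff_pInf, if_neg, coeff_part, if_pos hm, smul_zero, zero_add]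
      rintro rfl
      exact m₀_notMem_Δ₀ (mem_skeleton.mp hm)
    have eK : part skeleton H = part skeleton G + part skeleton E := by
      rw [hHE, part_add]
      congr 1
      exact Finset.sum_congr rfl fun m hm => by rw [hcK m hm]
    have n0 := norm_nonneg (coeff m₀ E)
    have nS := l1_nonneg (part shifts E)
    have nK := l1_nonneg (part skeleton E)
    refine ⟨hHQ, ?_, ?_, ?_, ?_⟩
    · rw [e0, add_sub_right_comm, hx']
      have := norm_add_le (coeff m₀ G - 1) (coeff m₀ E)
      linarith
    · rw [eS]
      linarith
    · rw [eK, hx']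
      have := l1_add_le (part skeleton G) (part skeleton E)
      linarith
    · have e : H - F = (G - F) + (E - part shifts G) := by
        rw [hHE]
        linear_combination -hsplit
      have t1 := l1_add_le (G - F) (E - part shifts G)
      have t2 := l1_sub_le E (part shifts G)
      rw [e, hx']
      linarith

lemma row_sum_step_iter_le {F : Poly} (hF : F ∈ Q) (hψ : coeff m₀ F = 1) {β θ : ℝ} (hβθ : β ≤ θ)
    (hθ : 480 * θ ≤ 1) (hβ : l1 (part shifts F) ≤ β) (hρ : l1 (part skeleton F) ≤ θ) (l : ℕ)
    (i : Fin 5) : ∑ j, ‖(step (iter F l) - 1) i j‖ ≤ 2 * β * (240 * θ) ^ l := by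
  obtain ⟨-, h1, h2, -⟩ := iter_bounds hF hψ hβθ hθ hβ hρ l
  have hx0 : (0 : ℝ) < (1 / 2) ^ l := by positivity
  have hβ0 : 0 ≤ β := (l1_nonneg _).trans hβ
  have hψ2 : 1 / 2 ≤ ‖coeff m₀ (iter F l)‖ := by
    have := norm_sub_norm_le (1 : ℂ) (coeff m₀ (iter F l))
    rw [norm_one, norm_sub_rev] at this
    nlinarith
  have hψinv : ‖coeff m₀ (iter F l)‖⁻¹ ≤ 2 := by
    rw [inv_le_comm₀ (by linarith) (by norm_num)]
    linarith
  rw [step_eq, add_sub_cancel_left]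
  refine (row_sum_step_le _ i).trans ?_
  rw [mul_assoc]
  exact mul_le_mul hψinv h2 (l1_nonneg _) (by norm_num)

section Limit

open scoped Matrix.Norms.Operator

lemma norm_le_of_row_sum_le {A : Matrix (Fin 5) (Fin 5) ℂ} {a : ℝ} (ha : 0 ≤ a)
    (h : ∀ i, ∑ j, ‖A i j‖ ≤ a) : ‖A‖ ≤ a := by
  lift a to NNReal using ha
  rw [linfty_opNorm_def, NNReal.coe_le_coe, Finset.sup_le_iff]
  intro i _
  have := h i
  rw [← NNReal.coe_le_coe]
  push_cast
  exact this

/-- In the row-sum norm the factors differ from the identity by a geometric series. The partial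
products therefore stay within `8β` of the identity and form a Cauchy sequence; `8β < 1` makes the
limit invertible. -/
lemma exists_tendsto_partialProd {F : Poly} (hF : F ∈ Q) (hψ : coeff m₀ F = 1) {β θ : ℝ}
    (hβθ : β ≤ θ) (hθ : 480 * θ ≤ 1) (hβ : l1 (part shifts F) ≤ β)
    (hρ : l1 (part skeleton F) ≤ θ) :
    ∃ L : GL (Fin 5) ℂ, Tendsto (partialProd F) atTop (𝓝 (L : Matrix (Fin 5) (Fin 5) ℂ)) := by
  have hβ0 : 0 ≤ β := (l1_nonneg _).trans hβ
  have hs : ∀ l, ‖step (iter F l) - 1‖ ≤ 2 * β * (1 / 2) ^ l := fun l => by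
    refine norm_le_of_row_sum_le (by positivity) fun i =>
      (row_sum_step_iter_le hF hψ hβθ hθ hβ hρ l i).trans ?_
    exact mul_le_mul_of_nonneg_left (pow_le_pow_left₀ (by linarith) (by linarith) l)
      (by positivity)
  have hd : ∀ l, partialProd F (l + 1) - partialProd F l =
      partialProd F l * (step (iter F l) - 1) := fun l => by
    rw [partialProd, mul_sub, mul_one]
  have hnd : ∀ l, ‖partialProd F (l + 1) - partialProd F l‖ ≤
      ‖partialProd F l‖ * (2 * β * (1 / 2) ^ l) := fun l => by
    rw [hd]
    exact (norm_mul_le _ _).trans (mul_le_mul_of_nonneg_left (hs l) (norm_nonneg _))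
  have hP : ∀ l, ‖partialProd F l - 1‖ ≤ 8 * β * (1 - (1 / 2) ^ l) := fun l => by
    induction l with
    | zero => simp [partialProd]
    | succ l ih =>
      have hx0 : (0 : ℝ) < (1 / 2) ^ l := by positivity
      have h1 : ‖partialProd F l‖ ≤ 2 := by
        have := norm_add_le (partialProd F l - 1) 1
        rw [sub_add_cancel, norm_one] at this
        nlinarith
      have h2 := (hnd l).trans (mul_le_mul_of_nonneg_right h1 (by positivity))
      have h3 := norm_add_le (partialProd F (l + 1) - partialProd F l) (partialProd F l - 1)
      rw [sub_add_sub_cancel] at h3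
      rw [pow_succ]
      linarith
  have hP2 : ∀ l, ‖partialProd F l‖ ≤ 2 := fun l => by
    have hx0 : (0 : ℝ) < (1 / 2) ^ l := by positivity
    have := norm_add_le (partialProd F l - 1) 1
    have := hP l
    rw [sub_add_cancel, norm_one] at *
    nlinarith
  have hc : CauchySeq (partialProd F) := by
    refine cauchySeq_of_le_geometric (1 / 2) (4 * β) (by norm_num) fun l => ?_
    rw [dist_comm, dist_eq_norm]
    have := (hnd l).trans (mul_le_mul_of_nonneg_right (hP2 l) (by positivity))
    linarith
  obtain ⟨L, hL⟩ := cauchySeq_tendsto_of_complete hc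
  have hL1 : ‖L - 1‖ ≤ 8 * β := by
    refine le_of_tendsto (hL.sub_const 1).norm (Eventually.of_forall fun l => (hP l).trans ?_)
    have hx0 : (0 : ℝ) < (1 / 2) ^ l := by positivity
    nlinarith
  have hu : IsUnit L := by
    have := isUnit_one_sub_of_norm_lt_one (x := 1 - L) (by rw [norm_sub_rev]; linarith)
    rwa [sub_sub_cancel] at this
  exact ⟨hu.unit, hL⟩

end Limit

/-- The limit of the iteration brings a quintic with `ψ = 1` to the normal form. -/
theorem exists_normalForm {F : Poly} (hF : F ∈ Q) (hψ : coeff m₀ F = 1) {β θ : ℝ}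
    (hβθ : β ≤ θ) (hθ : 480 * θ ≤ 1) (hβ : l1 (part shifts F) ≤ β)
    (hρ : l1 (part skeleton F) ≤ θ) :
    ∃ L : GL (Fin 5) ℂ, Tendsto (partialProd F) atTop (𝓝 (L : Matrix (Fin 5) (Fin 5) ℂ)) ∧
      ‖coeff m₀ (subst (L : Matrix (Fin 5) (Fin 5) ℂ) F) - 1‖ ≤ β ∧
      (∀ j k, j ≠ k → coeff (mShift j k) (subst (L : Matrix (Fin 5) (Fin 5) ℂ) F) = 0) ∧
      ∀ m, ‖coeff m (subst (L : Matrix (Fin 5) (Fin 5) ℂ) F) - coeff m F‖ ≤ 4 * β := by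
  obtain ⟨L, hL⟩ := exists_tendsto_partialProd hF hψ hβθ hθ hβ hρ
  have hβ0 : 0 ≤ β := (l1_nonneg _).trans hβ
  have hc : ∀ m, Tendsto (fun l => coeff m (iter F l)) atTop
      (𝓝 (coeff m (subst (L : Matrix (Fin 5) (Fin 5) ℂ) F))) := fun m => by
    simp only [iter_eq_subst]
    exact ((continuous_coeff_subst F m).tendsto _).comp hL
  have hB := iter_bounds hF hψ hβθ hθ hβ hρ
  refine ⟨L, hL, ?_, fun j k hjk => ?_, fun m => ?_⟩
  · refine le_of_tendsto ((hc m₀).sub_const 1).norm (Eventually.of_forall fun l =>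
      (hB l).2.1.trans ?_)
    have hx0 : (0 : ℝ) < (1 / 2) ^ l := by positivity
    nlinarith
  · refine tendsto_nhds_unique (hc _) (squeeze_zero_norm (a := fun l => β * (240 * θ) ^ l)
      (fun l => ?_) ?_)
    · refine le_trans ?_ (hB l).2.2.1
      rw [l1_part]
      exact Finset.single_le_sum (f := fun m => ‖coeff m (iter F l)‖)
        (fun _ _ => norm_nonneg _) (mShift_mem_shifts hjk)
    · have := (tendsto_pow_atTop_nhds_zero_of_lt_one (r := 240 * θ) (by linarith)
        (by linarith)).const_mul β
      rwa [mul_zero] at this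
  · refine le_of_tendsto ((hc m).sub_const (coeff m F)).norm (Eventually.of_forall fun l => ?_)
    rw [← coeff_sub]
    refine (norm_coeff_le_l1 _ _).trans ((hB l).2.2.2.2.trans ?_)
    have hx0 : (0 : ℝ) < (1 / 2) ^ l := by positivity
    nlinarith

/-- Rescaling a quintic in normal form to a point of `Q₀`. -/
lemma inv_smul_mem_Q₀ {G : Poly} (hG : G ∈ Q) (h0 : coeff m₀ G ≠ 0)
    (hB : ∀ j k, j ≠ k → coeff (mShift j k) G = 0) : (coeff m₀ G)⁻¹ • G ∈ Q₀ := by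
  refine mem_Q₀_iff.mpr ⟨Q.smul_mem _ hG, ?_, fun j k hjk => ?_⟩
  · rw [coeff_smul, smul_eq_mul, inv_mul_cancel₀ h0]
  · rw [coeff_smul, hB j k hjk, smul_zero]

/-- For large `ψ` the iteration converges and brings a quintic to the normal form. -/
theorem normalForm_of_large (c : ℝ) : ∃ R K : ℝ, 0 < R ∧ ∀ F ∈ Q,
    (∀ m, m ≠ m₀ → ‖coeff m F‖ ≤ c) → R ≤ ‖coeff m₀ F‖ →
    (∀ l i j, ‖(step (iter F l) - 1) i j‖ ≤ (K / ‖coeff m₀ F‖) ^ (l + 1)) ∧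
    ∃ L : GL (Fin 5) ℂ, Tendsto (partialProd F) atTop (𝓝 (L : Matrix (Fin 5) (Fin 5) ℂ)) ∧
      coeff m₀ (subst (L : Matrix (Fin 5) (Fin 5) ℂ) F) ≠ 0 ∧
      (coeff m₀ (subst (L : Matrix (Fin 5) (Fin 5) ℂ) F))⁻¹ •
        subst (L : Matrix (Fin 5) (Fin 5) ℂ) F ∈ Q₀ := by
  set M : ℝ := degFive.card * |c| with hM
  have hM0 : 0 ≤ M := by positivity
  -- After division by `ψ` both parts are bounded by `θ = M / ‖ψ‖`, and the iteration needs `480 θ ≤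
  -- 1`. Its rate `240 θ` is `K / ‖ψ‖`. The `+ 1` keeps `R` positive when `M = 0`.
  refine ⟨480 * M + 1, 240 * M, by positivity, fun F hF hc hR => ?_⟩
  set ψ := coeff m₀ F with hψ
  have hpos : 0 < ‖ψ‖ := by linarith
  have hψ0 : ψ ≠ 0 := norm_pos_iff.mp hpos
  set G := ψ⁻¹ • F with hG
  have hGQ : G ∈ Q := Q.smul_mem _ hF
  have hG1 : coeff m₀ G = 1 := by rw [hG, coeff_smul, smul_eq_mul, inv_mul_cancel₀ hψ0]
  have hFG : F = ψ • G := by rw [hG, smul_smul, mul_inv_cancel₀ hψ0, one_smul]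
  set θ := M / ‖ψ‖ with hθ
  have hθ1 : 480 * θ ≤ 1 := by
    rw [hθ, ← mul_div_assoc, div_le_one hpos]
    linarith
  have hpart : ∀ s : Finset (Fin 5 →₀ ℕ), m₀ ∉ s → l1 (part s G) ≤ θ := fun s hs => by
    have h1 := l1_part_le_of_coeff_le hF (abs_nonneg c) (s := s) fun m hm =>
      (hc m fun h => hs (h ▸ hm)).trans (le_abs_self c)
    rw [hG, part_smul, l1_smul, norm_inv, hθ, div_eq_inv_mul]
    exact mul_le_mul_of_nonneg_left h1 (by positivity)
  have hβ := hpart shifts fun h => by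
    obtain ⟨j, k, hjk, e⟩ := mem_shifts.mp h
    exact mShift_ne_m₀ hjk e.symm
  have hρ := hpart skeleton fun h => m₀_notMem_Δ₀ (mem_skeleton.mp h)
  have hθ0 : 0 ≤ θ := div_nonneg hM0 hpos.le
  constructor
  · intro l i j
    rw [hFG, iter_smul hψ0, step_smul hψ0]
    have h1 := row_sum_step_iter_le hGQ hG1 le_rfl hθ1 hβ hρ l i
    have h2 : ‖(step (iter G l) - 1) i j‖ ≤ ∑ j, ‖(step (iter G l) - 1) i j‖ :=
      Finset.single_le_sum (f := fun j => ‖(step (iter G l) - 1) i j‖)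
        (fun _ _ => norm_nonneg _) (Finset.mem_univ j)
    refine h2.trans (h1.trans ?_)
    rw [mul_div_assoc, ← hθ, pow_succ']
    exact mul_le_mul_of_nonneg_right (by linarith) (pow_nonneg (by linarith) l)
  · obtain ⟨L, hL, h0, hB, -⟩ := exists_normalForm hGQ hG1 le_rfl hθ1 hβ hρ
    have h1 : coeff m₀ (subst (L : Matrix (Fin 5) (Fin 5) ℂ) G) ≠ 0 := fun h => by
      rw [h, zero_sub, norm_neg, norm_one] at h0
      linarith
    have h2 : coeff m₀ (subst (L : Matrix (Fin 5) (Fin 5) ℂ) F) ≠ 0 := by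
      rw [hFG, subst_smul, coeff_smul]
      exact mul_ne_zero hψ0 h1
    refine ⟨L, ?_, h2, inv_smul_mem_Q₀ (subst_mem_Q hF _) h2 fun j k hjk => ?_⟩
    · rw [hFG]
      refine hL.congr fun l => (partialProd_smul hψ0 G l).symm
    · rw [hFG, subst_smul, coeff_smul, hB j k hjk, smul_zero]

/-! ### The saturation of the slice is open -/

lemma norm_inv_mul_sub_le {c z : ℂ} {y : ℝ} (hc : ‖c - 1‖ ≤ y) (hy : y ≤ 1 / 2) :
    ‖c⁻¹ * z - z‖ ≤ 2 * y * ‖z‖ := by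
  have h1 : 1 / 2 ≤ ‖c‖ := by
    have := norm_sub_norm_le (1 : ℂ) c
    rw [norm_one, norm_sub_rev] at this
    linarith
  have h0 : c ≠ 0 := norm_pos_iff.mp (by linarith)
  have h2 : ‖c‖⁻¹ ≤ 2 := by
    rw [inv_le_comm₀ (by linarith) (by norm_num)]
    linarith
  have e : c⁻¹ * z - z = c⁻¹ * (1 - c) * z := by field_simp
  rw [e, norm_mul, norm_mul, norm_inv, norm_sub_rev]
  exact mul_le_mul_of_nonneg_right (mul_le_mul h2 hc (norm_nonneg _) (by norm_num)) (norm_nonneg _)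

lemma one_le_card_degFive : (1 : ℝ) ≤ degFive.card := by
  exact_mod_cast Finset.card_pos.mpr ⟨m₀, mem_degFive.mpr m₀_mem_Δ⟩

/-- A radius in which quintics can be brought to the normal form. -/
def radius : ℝ := (960 * degFive.card)⁻¹

lemma radius_pos : 0 < radius := by
  have := one_le_card_degFive
  exact inv_pos.mpr (by linarith)

lemma card_mul_radius : degFive.card * radius = 1 / 960 := by
  have := one_le_card_degFive
  rw [radius]
  field_simp

lemma radius_le : radius ≤ 1 / 960 := by
  nlinarith [card_mul_radius, one_le_card_degFive, radius_pos]

lemma norm_coeff_lt_of_near {ε : ℝ} {q : Poly} (hq : Near ε q pInf) {m : Fin 5 →₀ ℕ}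
    (hm : m ≠ m₀) : ‖coeff m q‖ < ε := by
  have := hq m
  rwa [coeff_pInf, if_neg hm.symm, sub_zero] at this

/-- Quintics close to a point of `Q₀` near `p_∞` are equivalent to close points of `Q₀`. -/
lemma exists_smul_subst_mem_Q₀ {F q : Poly} (hF : F ∈ Q) (hq : q ∈ Q₀)
    (hnear : Near radius q pInf) {x : ℝ} (hx : 78 * (degFive.card * x) ≤ 1 / 96)
    (hFq : l1 (F - q) ≤ x) :
    ∃ (L : GL (Fin 5) ℂ) (c : ℂ), c ≠ 0 ∧
      c • subst (L : Matrix (Fin 5) (Fin 5) ℂ) F ∈ Q₀ ∧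
      ∀ m, ‖coeff m (c • subst (L : Matrix (Fin 5) (Fin 5) ℂ) F) - coeff m q‖ ≤
        78 * (degFive.card * x) := by
  obtain ⟨hqQ, hq1, hqB⟩ := mem_Q₀_iff.mp hq
  set M : ℝ := (degFive.card : ℝ) with hM
  have hM1 : 1 ≤ M := one_le_card_degFive
  have hx0 : 0 ≤ x := (l1_nonneg _).trans hFq
  have hMx : x ≤ M * x := le_mul_of_one_le_left hx0 hM1
  have hr := radius_le
  have hMr : M * radius = 1 / 960 := card_mul_radius
  have hFq' : ∀ m, ‖coeff m F - coeff m q‖ ≤ x := fun m => by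
    rw [← coeff_sub]
    exact (norm_coeff_le_l1 _ _).trans hFq
  set ψ := coeff m₀ F with hψ
  have hψ1 : ‖ψ - 1‖ ≤ x := by rw [← hq1]; exact hFq' m₀
  have hne : ∀ {c : ℂ} {y : ℝ}, ‖c - 1‖ ≤ y → y ≤ 1 / 2 → c ≠ 0 := by
    rintro c y h1 h2 rfl
    rw [zero_sub, norm_neg, norm_one] at h1
    linarith
  have hψ0 : ψ ≠ 0 := hne hψ1 (by linarith)
  have hq2 : ∀ m, ‖coeff m q‖ ≤ 1 := fun m => by
    by_cases hm : m = m₀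
    · rw [hm, hq1, norm_one]
    · linarith [norm_coeff_lt_of_near hnear hm]
  set G := ψ⁻¹ • F with hG
  have hGQ : G ∈ Q := Q.smul_mem _ hF
  have hG1 : coeff m₀ G = 1 := by rw [hG, coeff_smul, smul_eq_mul, inv_mul_cancel₀ hψ0]
  have hGq : ∀ m, ‖coeff m G - coeff m q‖ ≤ 6 * x := fun m => by
    have h1 : ‖coeff m F‖ ≤ 2 := by
      have := norm_add_le (coeff m F - coeff m q) (coeff m q)
      rw [sub_add_cancel] at this
      linarith [hFq' m, hq2 m]
    have h2 := norm_inv_mul_sub_le (z := coeff m F) hψ1 (by linarith)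
    rw [hG, coeff_smul, smul_eq_mul]
    have h3 := norm_add_le (ψ⁻¹ * coeff m F - coeff m F) (coeff m F - coeff m q)
    rw [sub_add_sub_cancel] at h3
    have h4 := mul_le_mul_of_nonneg_left h1 (show 0 ≤ 2 * x by linarith)
    linarith [hFq' m]
  set β := M * (6 * x) with hβdef
  have hβ : l1 (part shifts G) ≤ β := by
    refine l1_part_le_of_coeff_le hGQ (by linarith) fun m hm => ?_
    obtain ⟨j, k, hjk, rfl⟩ := mem_shifts.mp hm
    have := hGq (mShift j k)
    rwa [hqB j k hjk, sub_zero] at this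
  -- Half of `1 / 480` is `M * radius`, the contribution of `q`; the deviation `6 M x` fits into the
  -- other half.
  have hρ : l1 (part skeleton G) ≤ 1 / 480 := by
    refine (l1_part_le_of_coeff_le hGQ (c := radius + 6 * x) (by linarith [radius_pos])
      fun m hm => ?_).trans (by rw [← hM]; linarith)
    have h1 := norm_coeff_lt_of_near hnear (m := m) (by
      rintro rfl
      exact m₀_notMem_Δ₀ (mem_skeleton.mp hm))
    have h2 := norm_add_le (coeff m G - coeff m q) (coeff m q)
    rw [sub_add_cancel] at h2
    linarith [hGq m]
  obtain ⟨L, -, hL1, hLB, hLd⟩ := exists_normalForm hGQ hG1 (θ := 1 / 480) (by linarith)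
    (by norm_num) hβ hρ
  set H := subst (L : Matrix (Fin 5) (Fin 5) ℂ) G with hH
  have hH0 : coeff m₀ H ≠ 0 := hne hL1 (by linarith)
  have hHF : ((coeff m₀ H)⁻¹ * ψ⁻¹) • subst (L : Matrix (Fin 5) (Fin 5) ℂ) F =
      (coeff m₀ H)⁻¹ • H := by
    rw [hH, hG, subst_smul, smul_smul]
  refine ⟨L, (coeff m₀ H)⁻¹ * ψ⁻¹, mul_ne_zero (inv_ne_zero hH0) (inv_ne_zero hψ0), ?_, ?_⟩
  · rw [hHF]
    exact inv_smul_mem_Q₀ (subst_mem_Q hGQ _) hH0 hLB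
  · intro m
    rw [hHF, coeff_smul, smul_eq_mul]
    -- The final rescaling costs another `4β`. With `β = 6 M x` the total is at most `54 M x`, so
    -- the constant `78` has slack.
    have h1 : ‖coeff m H - coeff m q‖ ≤ 6 * x + 4 * β := by
      have := norm_add_le (coeff m H - coeff m G) (coeff m G - coeff m q)
      rw [sub_add_sub_cancel] at this
      linarith [hLd m, hGq m]
    have h2 : ‖coeff m H‖ ≤ 2 := by
      have := norm_add_le (coeff m H - coeff m q) (coeff m q)
      rw [sub_add_cancel] at this
      linarith [hq2 m]
    have h3 := norm_inv_mul_sub_le (z := coeff m H) hL1 (by linarith)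
    have h4 := mul_le_mul_of_nonneg_left h2 (show 0 ≤ 2 * β by linarith)
    have h5 := norm_add_le ((coeff m₀ H)⁻¹ * coeff m H - coeff m H) (coeff m H - coeff m q)
    rw [sub_add_sub_cancel] at h5
    linarith

lemma mem_slice_iff {ε : ℝ} {q : Poly} : q ∈ slice ε ↔ ∃ q₁ ∈ Q₀, Near ε q₁ pInf ∧
    ∃ t ∈ torus, q = subst (t : Matrix (Fin 5) (Fin 5) ℂ) q₁ := Iff.rfl

lemma mem_slice_of_near {ε : ℝ} {q : Poly} (hq : q ∈ Q₀) (h : Near ε q pInf) : q ∈ slice ε :=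
  mem_slice_iff.mpr ⟨q, hq, h, 1, torus.one_mem, by simp [subst_one]⟩

lemma mem_glOrbit_iff {F G : Poly} : G ∈ glOrbit F ↔
    ∃ g : GL (Fin 5) ℂ, G = subst (g : Matrix (Fin 5) (Fin 5) ℂ) F := Iff.rfl

lemma mem_torusOrbit_iff {F G : Poly} : G ∈ torusOrbit F ↔
    ∃ t ∈ torus, G = subst (t : Matrix (Fin 5) (Fin 5) ℂ) F := Iff.rfl

/-- A scalar matrix `d` multiplies quintics by `d ^ 5`, and `c` has a fifth root. Hence normalizing
`ψ` to one does not leave the orbit. -/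
lemma smul_mem_glOrbit {F G : Poly} (hF : F ∈ Q) (hG : G ∈ glOrbit F) {c : ℂ} (hc : c ≠ 0) :
    c • G ∈ glOrbit F := by
  obtain ⟨g, rfl⟩ := hG
  obtain ⟨d, hd⟩ := IsAlgClosed.exists_pow_nat_eq c (n := 5) (by norm_num)
  have hd0 : d ≠ 0 := by
    rintro rfl
    exact hc (by rw [← hd]; norm_num)
  have hu : IsUnit (d • (1 : Matrix (Fin 5) (Fin 5) ℂ)) := by
    rw [isUnit_iff_isUnit_det, det_smul, det_one, mul_one]
    exact (isUnit_iff_ne_zero.mpr hd0).pow _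
  refine ⟨g * hu.unit, ?_⟩
  rw [Units.val_mul, ← subst_subst, IsUnit.unit_spec, subst_smul_one d (subst_mem_Q hF _), hd]

/-- The torus element allowed in the slice is absorbed into `g`, leaving a representative that is
itself close to `p_∞`. -/
lemma exists_near_subst_of_mem_nearby {ε : ℝ} {p : Poly} (hp : p ∈ nearby ε) :
    ∃ g : GL (Fin 5) ℂ, subst (g : Matrix (Fin 5) (Fin 5) ℂ) p ∈ Q₀ ∧
      Near ε (subst (g : Matrix (Fin 5) (Fin 5) ℂ) p) pInf := by
  obtain ⟨-, q, ⟨g, hg⟩, q₁, hq₁, hnear, t, ht, hqt⟩ := hp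
  have e : subst ((g * ((t⁻¹ : SpecialLinearGroup (Fin 5) ℂ) : GL (Fin 5) ℂ) :
      GL (Fin 5) ℂ) : Matrix (Fin 5) (Fin 5) ℂ) p = q₁ := by
    rw [Units.val_mul, ← subst_subst, ← hg, hqt]
    rw [subst_subst]
    have : (t : Matrix (Fin 5) (Fin 5) ℂ) *
        (((t⁻¹ : SpecialLinearGroup (Fin 5) ℂ) : GL (Fin 5) ℂ) : Matrix (Fin 5) (Fin 5) ℂ) = 1 := by
      have h := congrArg (fun s : SpecialLinearGroup (Fin 5) ℂ => (s : Matrix (Fin 5) (Fin 5) ℂ))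
        (mul_inv_cancel t)
      exact h
    rw [this, subst_one]
  exact ⟨_, e ▸ hq₁, e ▸ hnear⟩

/-- Only finitely many coefficients can be nonzero, so the largest deviation is attained and the
strict inequalities have a common slack. -/
lemma exists_margin {ε : ℝ} {q : Poly} (hq : q ∈ Q₀) (h : Near ε q pInf) :
    ∃ μ > 0, ∀ m, ‖coeff m q - coeff m pInf‖ + μ ≤ ε := by
  obtain ⟨m', hm', hmax⟩ := degFive.exists_max_image (fun m => ‖coeff m q - coeff m pInf‖)
    ⟨m₀, mem_degFive.mpr m₀_mem_Δ⟩
  refine ⟨ε - ‖coeff m' q - coeff m' pInf‖, sub_pos.mpr (h m'), fun m => ?_⟩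
  by_cases hm : m ∈ degFive
  · linarith [hmax m hm]
  · rw [mem_degFive] at hm
    rw [coeff_eq_zero_of_mem_Q (mem_Q₀_iff.mp hq).1 hm, coeff_eq_zero_of_mem_Q pInf_mem_Q hm,
      sub_zero, norm_zero]
    linarith [norm_nonneg (coeff m' q - coeff m' pInf)]

/-- Transported by `g`, a perturbation of `p` becomes a perturbation of `q ∈ Q₀`; the normal form
returns it to `Q₀` at a distance from `q` smaller than the margin. -/
theorem isOpen_nearby {ε : ℝ} (hε1 : ε ≤ radius) {p : Poly} (hp : p ∈ nearby ε) :
    ∃ δ : ℝ, 0 < δ ∧ ∀ p' ∈ Q, Near δ p' p → p' ∈ nearby ε := by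
  obtain ⟨g, hq, hnear⟩ := exists_near_subst_of_mem_nearby hp
  have hpQ : p ∈ Q := hp.1
  set q := subst (g : Matrix (Fin 5) (Fin 5) ℂ) p with hqdef
  obtain ⟨μ, hμ, hmargin⟩ := exists_margin hq hnear
  set M : ℝ := (degFive.card : ℝ) with hM
  have hM1 : 1 ≤ M := one_le_card_degFive
  set a : ℝ := 1 + ∑ j, ∑ k, ‖(g : Matrix (Fin 5) (Fin 5) ℂ) j k‖ with ha
  have hs : 0 ≤ ∑ j, ∑ k, ‖(g : Matrix (Fin 5) (Fin 5) ℂ) j k‖ :=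
    Finset.sum_nonneg fun _ _ => Finset.sum_nonneg fun _ _ => norm_nonneg _
  have ha1 : 0 < a := by linarith
  have hrow : ∀ j, ∑ k, ‖(g : Matrix (Fin 5) (Fin 5) ℂ) j k‖ ≤ a := fun j => by
    have := Finset.single_le_sum (f := fun j => ∑ k, ‖(g : Matrix (Fin 5) (Fin 5) ℂ) j k‖)
      (fun j _ => Finset.sum_nonneg fun _ _ => norm_nonneg _) (Finset.mem_univ j)
    linarith
  set y : ℝ := min (1 / 96) (μ / 2) with hy
  have hy0 : 0 < y := lt_min (by norm_num) (by linarith)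
  set x : ℝ := y / (78 * M) with hx
  have hxy : 78 * (M * x) = y := by
    rw [hx]
    field_simp
  have hx0 : 0 < x := div_pos hy0 (by linarith)
  have haM : 0 < a ^ 5 * M := mul_pos (pow_pos ha1 5) (by linarith)
  -- Passing from coefficients to the `ℓ¹` norm costs a factor `M`, and substituting `g` costs `a ^
  -- 5`.
  refine ⟨x / (a ^ 5 * M), div_pos hx0 haM, fun p' hp' hpp' => ?_⟩
  have hl : l1 (subst (g : Matrix (Fin 5) (Fin 5) ℂ) p' - q) ≤ x := by
    rw [hqdef, ← subst_sub]
    refine (l1_subst_le hrow (Q.sub_mem hp' hpQ)).trans ?_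
    have h1 : l1 (p' - p) ≤ M * (x / (a ^ 5 * M)) :=
      l1_le_of_coeff_le (Q.sub_mem hp' hpQ) fun m => by
        rw [coeff_sub]
        exact (hpp' m).le
    refine (mul_le_mul_of_nonneg_left h1 (pow_pos ha1 5).le).trans (le_of_eq ?_)
    field_simp
  obtain ⟨L, c, hc, hcQ, hcn⟩ := exists_smul_subst_mem_Q₀ (subst_mem_Q hp' _) hq
    (fun m => (hnear m).trans_le hε1) (hxy.le.trans (min_le_left _ _)) hl
  refine ⟨hp', _, smul_mem_glOrbit hp' ⟨g * L, ?_⟩ hc, mem_slice_of_near hcQ fun m => ?_⟩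
  · rw [Units.val_mul, ← subst_subst]
  · have h1 := norm_add_le (coeff m (c • subst (L : Matrix (Fin 5) (Fin 5) ℂ)
      (subst (g : Matrix (Fin 5) (Fin 5) ℂ) p')) - coeff m q) (coeff m q - coeff m pInf)
    rw [sub_add_sub_cancel] at h1
    have h2 := hcn m
    rw [← hM, hxy] at h2
    linarith [hmargin m, min_le_right (1 / 96) (μ / 2)]

lemma pInf_mem_nearby {ε : ℝ} (hε : 0 < ε) : pInf ∈ nearby ε :=
  ⟨pInf_mem_Q, pInf, ⟨1, by simp [subst_one]⟩,
    mem_slice_of_near pInf_mem_Q₀ fun m => by simpa using hε⟩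

/-! ### Gaussian elimination with complete pivoting -/

/-- Gaussian elimination with complete pivoting, with bounds on the factors. -/
theorem exists_complete_pivoting (n : ℕ) (A : Matrix (Fin n) (Fin n) ℂ) :
    ∃ (σ τ : Equiv.Perm (Fin n)) (L V : Matrix (Fin n) (Fin n) ℂ) (d : Fin n → ℂ),
      ((∀ i, L i i = 1) ∧ (∀ i j, i < j → L i j = 0) ∧ ∀ i j, ‖L i j‖ ≤ 1) ∧
      ((∀ i, V i i = 1) ∧ (∀ i j, j < i → V i j = 0) ∧ ∀ i j, ‖V i j‖ ≤ n.factorial) ∧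
      A.submatrix σ τ * V = L * diagonal d ∧
      (∀ j k, k ≤ j → ‖d j‖ ≤ 2 ^ n * ‖d k‖) ∧
      ∀ M : ℝ, (∀ i j, ‖A i j‖ ≤ M) → ∀ j, ‖d j‖ ≤ 2 ^ n * M := by
  induction n with
  | zero => exact ⟨1, 1, 1, 1, 0, by simp, by simp, by simp [eq_iff_true_of_subsingleton],
      by simp, by simp⟩
  | succ n ih =>
    by_cases hA : A = 0
    · have h1 : ∀ i j : Fin (n + 1), ‖(1 : Matrix (Fin (n + 1)) (Fin (n + 1)) ℂ) i j‖ ≤ 1 :=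
        fun i j => by rw [Matrix.one_apply]; split_ifs <;> simp
      refine ⟨1, 1, 1, 1, 0, ⟨by simp, fun i j h => Matrix.one_apply_ne h.ne, h1⟩,
        ⟨by simp, fun i j h => Matrix.one_apply_ne h.ne', fun i j => (h1 i j).trans ?_⟩,
        by simp [hA], by simp, fun M hM j => ?_⟩
      · exact_mod_cast (n + 1).factorial_pos
      · have : 0 ≤ M := (norm_nonneg _).trans (hM 0 0)
        simpa using this
    obtain ⟨⟨i₀, j₀⟩, -, hmax⟩ := Finset.univ.exists_max_image
      (fun p : Fin (n + 1) × Fin (n + 1) => ‖A p.1 p.2‖) ⟨(0, 0), Finset.mem_univ _⟩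
    replace hmax : ∀ i j, ‖A i j‖ ≤ ‖A i₀ j₀‖ := fun i j => hmax (i, j) (Finset.mem_univ _)
    set a := A i₀ j₀ with ha
    have ha0 : a ≠ 0 := fun h => hA (by
      ext i j
      have := hmax i j
      rwa [h, norm_zero, norm_le_zero_iff] at this)
    have hapos : 0 < ‖a‖ := norm_pos_iff.mpr ha0
    have hdiv : ∀ i j, ‖A i j / a‖ ≤ 1 := fun i j => by
      rw [norm_div]
      exact div_le_one_of_le₀ (hmax i j) hapos.le
    set r : Fin n → Fin (n + 1) := fun i => Equiv.swap 0 i₀ i.succ with hr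
    set s : Fin n → Fin (n + 1) := fun j => Equiv.swap 0 j₀ j.succ with hs
    -- The Schur complement of the largest entry `a`. The multipliers have absolute value at most
    -- one, so its entries are at most `2‖a‖`; the last clause of the induction hypothesis turns
    -- this into the bound of all later pivots by `‖a‖`.
    set S : Matrix (Fin n) (Fin n) ℂ :=
      Matrix.of fun i j => A (r i) (s j) - A (r i) j₀ * (A i₀ (s j) / a) with hS
    obtain ⟨σ, τ, L, V, d, ⟨hL1, hL2, hL3⟩, ⟨hV1, hV2, hV3⟩, hE, hd1, hd2⟩ := ih S
    have hSn : ∀ i j, ‖S i j‖ ≤ 2 * ‖a‖ := fun i j => by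
      have h1 := norm_sub_le (A (r i) (s j)) (A (r i) j₀ * (A i₀ (s j) / a))
      have h2 : ‖A (r i) j₀ * (A i₀ (s j) / a)‖ ≤ ‖a‖ * 1 := by
        rw [norm_mul]
        exact mul_le_mul (hmax _ _) (hdiv _ _) (norm_nonneg _) hapos.le
      calc ‖S i j‖ ≤ _ := h1
        _ ≤ 2 * ‖a‖ := by linarith [hmax (r i) (s j)]
    have hd3 : ∀ j, ‖d j‖ ≤ 2 ^ (n + 1) * ‖a‖ := fun j => by
      have := hd2 _ hSn j
      rw [pow_succ]
      linarith
    have h2n : (1 : ℝ) ≤ 2 ^ (n + 1) := one_le_pow₀ (by norm_num)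
    refine ⟨Equiv.Perm.decomposeFin.symm (i₀, σ), Equiv.Perm.decomposeFin.symm (j₀, τ),
      Matrix.of (Fin.cons (Fin.cons 1 0) fun i => Fin.cons (A (r (σ i)) j₀ / a) (L i)),
      Matrix.of (Fin.cons (Fin.cons 1 fun j => -∑ k, A i₀ (s (τ k)) / a * V k j)
        fun i => Fin.cons 0 (V i)),
      Fin.cons a d, ⟨?_, ?_, ?_⟩, ⟨?_, ?_, ?_⟩, ?_, ?_, ?_⟩
    · refine Fin.cases (by simp) fun i => by simpa using hL1 i
    · refine Fin.cases (fun j => Fin.cases (by simp) (fun j _ => by simp) j)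
        fun i j => Fin.cases (by simp) (fun j h => ?_) j
      simpa using hL2 i j (Fin.succ_lt_succ_iff.mp h)
    · refine Fin.cases (fun j => Fin.cases (by simp) (fun j => by simp) j)
        fun i j => Fin.cases ?_ (fun j => ?_) j
      · simpa using hdiv (r (σ i)) j₀
      · simpa using hL3 i j
    · refine Fin.cases (by simp) fun i => by simpa using hV1 i
    · refine Fin.cases (fun j h => absurd h (by simp))
        fun i j => Fin.cases (by simp) (fun j h => ?_) j
      simpa using hV2 i j (Fin.succ_lt_succ_iff.mp h)
    · have hf : (n.factorial : ℝ) ≤ (n + 1).factorial := by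
        exact_mod_cast Nat.factorial_le n.le_succ
      have hf1 : (1 : ℝ) ≤ (n + 1).factorial := by exact_mod_cast (n + 1).factorial_pos
      refine Fin.cases (fun j => Fin.cases (by simpa using hf1) (fun j => ?_) j)
        fun i j => Fin.cases (by simp) (fun j => ?_) j
      -- The new first row of `V` is a sum of `n` terms of size at most `n!`, and `n · n! ≤ (n +
      -- 1)!`.
      · have h1 : ‖∑ k, A i₀ (s (τ k)) / a * V k j‖ ≤ ∑ _k : Fin n, (n.factorial : ℝ) := by
          refine norm_sum_le_of_le _ fun k _ => ?_
          rw [norm_mul, ← one_mul (n.factorial : ℝ)]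
          exact mul_le_mul (hdiv _ _) (hV3 k j) (norm_nonneg _) zero_le_one
        have h2 : ((n + 1).factorial : ℝ) = (n + 1) * n.factorial := by
          rw [Nat.factorial_succ]
          push_cast
          ring
        have h3 : (0 : ℝ) ≤ n.factorial := by positivity
        simp only [Finset.sum_const, Finset.card_univ, Fintype.card_fin, nsmul_eq_mul] at h1
        simp only [Matrix.of_apply, Fin.cons_zero, Fin.cons_succ, norm_neg]
        linarith
      · simpa using (hV3 i j).trans hf
    · have hE' : ∀ i j, ∑ k, S (σ i) (τ k) * V k j = L i j * d j := fun i j => by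
        have := congrFun (congrFun hE i) j
        rwa [mul_diagonal, Matrix.mul_apply] at this
      ext i j
      rw [mul_diagonal, Matrix.mul_apply, Fin.sum_univ_succ]
      refine Fin.cases (Fin.cases ?_ (fun j => ?_) j) (fun i => Fin.cases ?_ (fun j => ?_) j) i
      · simp [Equiv.Perm.decomposeFin_symm_apply_zero, ← ha]
      · simp only [submatrix_apply, Equiv.Perm.decomposeFin_symm_apply_zero,
          Equiv.Perm.decomposeFin_symm_apply_succ, Matrix.of_apply, Fin.cons_zero, Fin.cons_succ,
          ← ha, Pi.zero_apply, zero_mul]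
        rw [mul_neg, Finset.mul_sum, neg_add_eq_zero]
        refine Finset.sum_congr rfl fun k _ => ?_
        rw [← mul_assoc, mul_div_cancel₀ _ ha0]
      · simp only [submatrix_apply, Equiv.Perm.decomposeFin_symm_apply_zero,
          Equiv.Perm.decomposeFin_symm_apply_succ, Matrix.of_apply, Fin.cons_zero, Fin.cons_succ,
          mul_zero, Finset.sum_const_zero, add_zero, mul_one]
        exact (div_mul_cancel₀ _ ha0).symm
      · simp only [submatrix_apply, Equiv.Perm.decomposeFin_symm_apply_zero,
          Equiv.Perm.decomposeFin_symm_apply_succ, Matrix.of_apply, Fin.cons_zero, Fin.cons_succ]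
        rw [← hE', mul_neg, Finset.mul_sum, neg_add_eq_sub, ← Finset.sum_sub_distrib]
        refine Finset.sum_congr rfl fun k _ => ?_
        rw [hS, Matrix.of_apply, sub_mul, mul_assoc]
    · intro j k
      refine Fin.cases (fun hk => ?_) (fun j => Fin.cases (fun _ => ?_) (fun k hk => ?_) k) j
      · rw [le_antisymm hk (Fin.zero_le _)]
        exact le_mul_of_one_le_left (norm_nonneg _) h2n
      · simpa using hd3 j
      · have h1 := hd1 j k (Fin.succ_le_succ_iff.mp hk)
        simp only [Fin.cons_succ]
        refine h1.trans (mul_le_mul_of_nonneg_right ?_ (norm_nonneg _))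
        exact pow_le_pow_right₀ (by norm_num) n.le_succ
    · intro M hM
      have haM : ‖a‖ ≤ M := hM i₀ j₀
      refine Fin.cases ?_ fun j => ?_
      · simp only [Fin.cons_zero]
        nlinarith
      · simp only [Fin.cons_succ]
        exact (hd3 j).trans (mul_le_mul_of_nonneg_left haM (by linarith))

/-! ### Triangular substitutions -/

/-- The exponent `∑ e_{c(i)}`. -/
def mapExp (c : Fin 5 → Fin 5) : Fin 5 →₀ ℕ := ∑ i, Finsupp.single (c i) 1

/-- Expanding the product of the five linear forms, `c` records which variable is taken from each.
-/
lemma coeff_subst_pInf (A : Matrix (Fin 5) (Fin 5) ℂ) (m : Fin 5 →₀ ℕ) :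
    coeff m (subst A pInf) = ∑ c : Fin 5 → Fin 5, if mapExp c = m then ∏ i, A i (c i) else 0 := by
  have h : subst A pInf = ∑ c : Fin 5 → Fin 5, monomial (mapExp c) (∏ i, A i (c i)) := by
    rw [pInf, subst_prod]
    simp only [subst_X, linForm, Finset.prod_univ_sum, Fintype.piFinset_univ]
    refine Finset.sum_congr rfl fun c _ => ?_
    simp only [C_mul_X_eq_monomial, mapExp]
    exact (monomial_sum_prod _ _ _).symm
  rw [h, coeff_sum]
  simp only [coeff_monomial]

/-- The weight of an exponent. -/
def weight (w : Fin 5 → ℤ) (m : Fin 5 →₀ ℕ) : ℤ := ∑ i, m i * w i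

lemma weight_mapExp (w : Fin 5 → ℤ) (c : Fin 5 → Fin 5) :
    weight w (mapExp c) = ∑ i, w (c i) := by
  simp only [weight, mapExp, Finsupp.finsetSum_apply, Nat.cast_sum, Finset.sum_mul]
  rw [Finset.sum_comm]
  refine Finset.sum_congr rfl fun i _ => ?_
  simp [Finsupp.single_apply]

lemma mapExp_id : mapExp id = m₀ := by
  ext i
  simp [mapExp, m₀_apply, Finsupp.finsetSum_apply, Finsupp.single_apply]

lemma mapExp_update {j k : Fin 5} : mapExp (Function.update id j k) = mShift j k := by
  have h1 : m₀ = Finsupp.single j 1 + ∑ i ∈ Finset.univ.erase j, Finsupp.single i 1 := by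
    rw [Finset.add_sum_erase _ (fun i => Finsupp.single i 1) (Finset.mem_univ j)]
    exact mapExp_id.symm
  rw [mShift, h1, add_tsub_cancel_left, mapExp, ← Finset.add_sum_erase _ _ (Finset.mem_univ j),
    Function.update_self, add_comm]
  congr 1
  refine Finset.sum_congr rfl fun i hi => ?_
  rw [Function.update_of_ne (Finset.ne_of_mem_erase hi), id]

lemma weight_m₀ (w : Fin 5 → ℤ) : weight w m₀ = ∑ i, w i := by
  rw [← mapExp_id, weight_mapExp]
  rfl

lemma weight_mShift (w : Fin 5 → ℤ) (j k : Fin 5) :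
    weight w (mShift j k) = ∑ i, w i + (w k - w j) := by
  rw [← mapExp_update, weight_mapExp, ← Finset.add_sum_erase _ _ (Finset.mem_univ j),
    ← Finset.add_sum_erase _ w (Finset.mem_univ j), Function.update_self]
  have : ∀ i ∈ Finset.univ.erase j, w (Function.update id j k i) = w i := fun i hi => by
    rw [Function.update_of_ne (Finset.ne_of_mem_erase hi), id]
  rw [Finset.sum_congr rfl this]
  ring

/-- A matrix that is unipotent and triangular with respect to the order given by `w`. -/
structure IsUnitriangular (w : Fin 5 → ℤ) (A : Matrix (Fin 5) (Fin 5) ℂ) : Prop where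
  diag : ∀ i, A i i = 1
  lt_of_ne_zero : ∀ i j, i ≠ j → A i j ≠ 0 → w j < w i

namespace IsUnitriangular

variable {w : Fin 5 → ℤ} {A : Matrix (Fin 5) (Fin 5) ℂ}

lemma le_of_prod_ne_zero (hA : IsUnitriangular w A) {c : Fin 5 → Fin 5}
    (h : ∏ i, A i (c i) ≠ 0) (i : Fin 5) : w (c i) ≤ w i := by
  by_cases hi : i = c i
  · rw [← hi]
  · exact (hA.lt_of_ne_zero i (c i) hi (Finset.prod_ne_zero_iff.mp h i (Finset.mem_univ i))).le

/-- A choice with nonzero product raises the weight of no factor. If the total weight is kept, every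
weight is kept, and injectivity of `w` leaves only the identity. -/
lemma coeff_m₀_subst_pInf (hA : IsUnitriangular w A) (hw : Function.Injective w) :
    coeff m₀ (subst A pInf) = 1 := by
  rw [coeff_subst_pInf, Finset.sum_eq_single id]
  · rw [if_pos mapExp_id]
    exact Finset.prod_eq_one fun i _ => hA.diag i
  · intro c _ hc
    by_contra hne
    obtain ⟨hm, hp⟩ := ite_ne_right_iff.mp hne
    have hsum := weight_mapExp w c
    rw [hm, weight_m₀] at hsum
    have := (Finset.sum_eq_sum_iff_of_le fun i _ => hA.le_of_prod_ne_zero hp i).mp hsum.symm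
    exact hc (funext fun i => hw (this i (Finset.mem_univ i)))
  · simp

/-- Such a monomial is heavier than `z^{m₀}`, and no nonzero choice increases the weight. -/
lemma coeff_mShift_subst_pInf_of_lt (hA : IsUnitriangular w A) {j k : Fin 5} (hjk : w j < w k) :
    coeff (mShift j k) (subst A pInf) = 0 := by
  rw [coeff_subst_pInf]
  refine Finset.sum_eq_zero fun c _ => ?_
  by_contra hne
  obtain ⟨hm, hp⟩ := ite_ne_right_iff.mp hne
  have hsum := weight_mapExp w c
  rw [hm, weight_mShift] at hsum
  have := Finset.sum_le_sum fun i (_ : i ∈ Finset.univ) => hA.le_of_prod_ne_zero hp i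
  linarith

/-- The choice replacing only `j` by `k` contributes `A j k`. Any other nonzero contribution
contains an off-diagonal entry with a strictly smaller weight drop, bounded by `η`, and four further
factors bounded by `b`. There are `5 ^ 5 = 3125` choices in all. This allows a recursion on the
distance to the diagonal. -/
lemma norm_coeff_mShift_subst_pInf_sub_le (hA : IsUnitriangular w A)
    (hw : Function.Injective w) {b η : ℝ} (hb : ∀ i j, ‖A i j‖ ≤ b) {j k : Fin 5} (hjk : j ≠ k)
    (hη0 : 0 ≤ η) (hη : ∀ i i', i ≠ i' → w i - w i' < w j - w k → ‖A i i'‖ ≤ η) :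
    ‖coeff (mShift j k) (subst A pInf) - A j k‖ ≤ 3125 * (b ^ 4 * η) := by
  have hb0 : 0 ≤ b := (norm_nonneg _).trans (hb 0 0)
  have hu : ∏ i, A i (Function.update id j k i) = A j k := by
    rw [← Finset.mul_prod_erase _ _ (Finset.mem_univ j), Function.update_self,
      Finset.prod_eq_one, mul_one]
    intro i hi
    rw [Function.update_of_ne (Finset.ne_of_mem_erase hi), id, hA.diag]
  rw [coeff_subst_pInf, ← Finset.add_sum_erase _ _ (Finset.mem_univ (Function.update id j k)),
    if_pos mapExp_update, hu, add_sub_cancel_left]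
  have hcard : ((Finset.univ.erase (Function.update id j k)).card : ℝ) ≤ 3125 := by
    have : (Finset.univ.erase (Function.update id j k)).card ≤
        (Finset.univ : Finset (Fin 5 → Fin 5)).card := Finset.card_le_card (Finset.subset_univ _)
    rw [Finset.card_univ, Fintype.card_fun, Fintype.card_fin] at this
    exact_mod_cast this
  have hterm : ∀ c ∈ Finset.univ.erase (Function.update id j k),
      ‖if mapExp c = mShift j k then ∏ i, A i (c i) else 0‖ ≤ b ^ 4 * η := fun c hc => by
    by_cases hne : (if mapExp c = mShift j k then ∏ i, A i (c i) else 0) = 0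
    · rw [hne, norm_zero]
      positivity
    obtain ⟨hm, hp⟩ := ite_ne_right_iff.mp hne
    rw [if_pos hm]
    have hle := hA.le_of_prod_ne_zero hp
    have hsum := weight_mapExp w c
    rw [hm, weight_mShift] at hsum
    obtain ⟨i, hi⟩ : ∃ i, c i ≠ i := by
      by_contra! hcon
      have : c = id := funext hcon
      rw [this, mapExp_id] at hm
      exact mShift_ne_m₀ hjk hm.symm
    -- The drops are nonnegative and add up to `w j - w k`. If index `i` used up the whole drop, all
    -- other indices would be fixed, and the exponent would identify `c` with the excluded choice.
    have hlt : w i - w (c i) < w j - w k := by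
      by_contra! hge
      rw [← Finset.add_sum_erase _ w (Finset.mem_univ i),
        ← Finset.add_sum_erase _ (fun i => w (c i)) (Finset.mem_univ i)] at hsum
      have hle' := Finset.sum_le_sum fun i' (_ : i' ∈ Finset.univ.erase i) => hle i'
      have heq : ∑ i' ∈ Finset.univ.erase i, w (c i') = ∑ i' ∈ Finset.univ.erase i, w i' := by
        linarith
      have hfix := (Finset.sum_eq_sum_iff_of_le fun i' _ => hle i').mp heq
      have hcu : c = Function.update id i (c i) := by
        funext i'
        by_cases h : i' = i
        · rw [h, Function.update_self]
        · rw [Function.update_of_ne h, id]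
          exact hw (hfix i' (by simp [h]))
      rw [hcu, mapExp_update] at hm
      obtain ⟨h1, h2⟩ := mShift_inj hi.symm hjk hm
      rw [h1] at hcu h2
      rw [h2] at hcu
      exact Finset.ne_of_mem_erase hc hcu
    rw [← Finset.mul_prod_erase _ _ (Finset.mem_univ i), norm_mul, mul_comm, norm_prod]
    refine mul_le_mul ?_ (hη i (c i) hi.symm hlt) (norm_nonneg _) (by positivity)
    refine (Finset.prod_le_prod (fun _ _ => norm_nonneg _) fun i' _ => hb i' (c i')).trans ?_
    simp
  refine (norm_sum_le_of_le _ hterm).trans ?_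
  rw [Finset.sum_const, nsmul_eq_mul]
  exact mul_le_mul_of_nonneg_right hcard (by positivity)

end IsUnitriangular

/-- A Lipschitz constant for triangular substitutions with entries at most `120`. -/
def lipConst : ℝ := 25 * 601 ^ 4

/-- The remainder `q - p_∞` has no coefficient outside `Δ⁰`, so what it contributes there is due to
`A - 1` alone. The resulting factor `n` beside `ρ` is what later makes the estimate for `n`
self-improving. -/
lemma coeff_subst_sub_le {A : Matrix (Fin 5) (Fin 5) ℂ} {n ρ : ℝ} (hA1 : ∀ i, A i i = 1)
    (hn : n ≤ 120) (hA : ∀ i j, i ≠ j → ‖A i j‖ ≤ n) {q : Poly} (hq : q ∈ Q₀)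
    (hρ : l1 (q - pInf) ≤ ρ) {m : Fin 5 →₀ ℕ} (hm : m ∉ Δ₀) :
    ‖coeff m (subst A q) - coeff m (subst A pInf)‖ ≤ lipConst * n * ρ := by
  have hn0 : 0 ≤ n := (norm_nonneg _).trans (hA 0 1 (by decide))
  have hr : q - pInf ∈ spanΔ₀ := mem_Q₀_iff_sub.mp hq
  have hrQ : q - pInf ∈ Q := Q.sub_mem (mem_Q₀_iff.mp hq).1 pInf_mem_Q
  have hr0 : coeff m (q - pInf) = 0 := by
    by_contra h
    exact hm (mem_spanΔ₀_iff.mp hr m h)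
  have hrow : ∀ i, ∑ j, ‖(A - 1) i j‖ ≤ 5 * n := fun i => by
    have : ∀ j ∈ Finset.univ, ‖(A - 1) i j‖ ≤ n := fun j _ => by
      by_cases h : i = j
      · simpa [h, hA1] using hn0
      · simpa [Matrix.one_apply_ne h] using hA i j h
    simpa using Finset.sum_le_card_nsmul _ _ _ this
  have h1 := l1_subst_sub_le hrow hrQ
  rw [add_sub_cancel] at h1
  have h2 := norm_coeff_le_l1 m (subst A (q - pInf) - (q - pInf))
  have h2' : coeff m (subst A q) - coeff m (subst A pInf) =
      coeff m (subst A (q - pInf) - (q - pInf)) := by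
    rw [coeff_sub, hr0, sub_zero, subst_sub, coeff_sub]
  have h3 : (1 + 5 * n) ^ 5 - 1 ≤ lipConst * n := by
    have e : (1 + 5 * n) ^ 5 - 1 = 5 * n * ((1 + 5 * n) ^ 4 + (1 + 5 * n) ^ 3 + (1 + 5 * n) ^ 2 +
        (1 + 5 * n) + 1) := by ring
    have hy : 1 ≤ 1 + 5 * n := by linarith
    have hp : ∀ k ≤ 4, (1 + 5 * n) ^ k ≤ 601 ^ 4 := fun k hk =>
      (pow_le_pow_right₀ hy hk).trans (pow_le_pow_left₀ (by linarith) (by linarith) 4)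
    have p4 := hp 4 le_rfl
    have p3 := hp 3 (by norm_num)
    have p2 := hp 2 (by norm_num)
    have p1 := hp 1 (by norm_num)
    have p0 := hp 0 (by norm_num)
    rw [pow_one] at p1
    rw [pow_zero] at p0
    rw [e, lipConst]
    have := mul_le_mul_of_nonneg_left (add_le_add (add_le_add (add_le_add (add_le_add p4 p3) p2)
      p1) p0) (show 0 ≤ 5 * n by linarith)
    linarith
  have hC : 0 ≤ lipConst * n := mul_nonneg (by norm_num [lipConst]) hn0
  rw [h2']
  exact h2.trans (h1.trans (mul_le_mul h3 hρ (l1_nonneg _) hC))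

/-- A constant for the recovery of a triangular matrix from the coefficients of `z^{m_{jk}}`. -/
def recConst : ℝ := 1 + 3125 * 120 ^ 4

namespace IsUnitriangular

variable {w : Fin 5 → ℤ} {A : Matrix (Fin 5) (Fin 5) ℂ} {n ρ : ℝ} {q : Poly}

lemma norm_le (hA : IsUnitriangular w A) (hn : n ≤ 120) (hAn : ∀ i j, i ≠ j → ‖A i j‖ ≤ n)
    (i j : Fin 5) : ‖A i j‖ ≤ 120 := by
  by_cases h : i = j
  · rw [h, hA.diag, norm_one]
    norm_num
  · exact (hAn i j h).trans hn

/-- The entries of a unitriangular matrix are controlled by the coefficients of `z^{m_{jk}}` in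
`q(Az)`. -/
lemma norm_le_of_coeff_le (hA : IsUnitriangular w A) (hw : Function.Injective w)
    (hw4 : ∀ i j, w i - w j ≤ 4) (hn : n ≤ 120) (hAn : ∀ i j, i ≠ j → ‖A i j‖ ≤ n) (hq : q ∈ Q₀)
    (hρ : l1 (q - pInf) ≤ ρ) {γ : ℝ}
    (hγ : ∀ j k, w k < w j → ‖coeff (mShift j k) (subst A q)‖ ≤ γ) (j k : Fin 5) (hjk : j ≠ k) :
    ‖A j k‖ ≤ recConst ^ 4 * (γ + lipConst * n * ρ) := by
  have hn0 : 0 ≤ n := (norm_nonneg _).trans (hAn 0 1 (by decide))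
  have hγ0 : 0 ≤ γ := by
    rcases lt_or_gt_of_ne (hw.ne hjk) with h | h
    · exact (norm_nonneg _).trans (hγ k j h)
    · exact (norm_nonneg _).trans (hγ j k h)
  have hρ0 : 0 ≤ ρ := (l1_nonneg _).trans hρ
  set x := γ + lipConst * n * ρ with hx
  have hx0 : 0 ≤ x := add_nonneg hγ0 (mul_nonneg (mul_nonneg (by norm_num [lipConst]) hn0) hρ0)
  have hR : 1 ≤ recConst := by norm_num [recConst]
  -- Induction on the weight drop: entries with smaller drop bound the mixed products, and each
  -- level costs a factor `recConst`. Four levels suffice by `hw4`.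
  have key : ∀ d : ℕ, ∀ j k, j ≠ k → w j - w k ≤ d → ‖A j k‖ ≤ recConst ^ d * x := by
    intro d
    induction d with
    | zero =>
      intro j k hjk hd
      have : A j k = 0 := by
        by_contra h
        have := hA.lt_of_ne_zero j k hjk h
        push_cast at hd
        linarith
      rw [this, norm_zero, pow_zero, one_mul]
      exact hx0
    | succ d ih =>
      intro j k hjk hd
      by_cases h : A j k = 0
      · rw [h, norm_zero]
        exact mul_nonneg (pow_nonneg (by linarith) _) hx0
      have hlt := hA.lt_of_ne_zero j k hjk h
      have hη0 : 0 ≤ recConst ^ d * x := mul_nonneg (pow_nonneg (by linarith) _) hx0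
      have h1 := hA.norm_coeff_mShift_subst_pInf_sub_le hw (hA.norm_le hn hAn) hjk hη0
        fun i i' hii hlt' => ih i i' hii (by push_cast at hd; linarith)
      have h2 := coeff_subst_sub_le hA.diag hn hAn hq hρ (mShift_notMem_Δ₀ hjk)
      have h3 := hγ j k hlt
      have h4 : ‖A j k‖ ≤ γ + lipConst * n * ρ + 3125 * (120 ^ 4 * (recConst ^ d * x)) := by
        have e : A j k = coeff (mShift j k) (subst A q) -
            (coeff (mShift j k) (subst A q) - coeff (mShift j k) (subst A pInf)) -
            (coeff (mShift j k) (subst A pInf) - A j k) := by ring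
        rw [e]
        refine (norm_sub_le _ _).trans (add_le_add ((norm_sub_le _ _).trans ?_) h1)
        exact add_le_add h3 h2
      have h5 : x ≤ recConst ^ d * x := le_mul_of_one_le_left hx0 (one_le_pow₀ hR)
      have h6 : ∀ z : ℝ, recConst * z = z + 3125 * (120 ^ 4 * z) := fun z => by
        rw [recConst]
        ring
      rw [pow_succ', mul_assoc, h6]
      linarith
  exact key 4 j k hjk (by exact_mod_cast hw4 j k)

lemma norm_coeff_m₀_sub_one_le (hA : IsUnitriangular w A) (hw : Function.Injective w)
    (hn : n ≤ 120) (hAn : ∀ i j, i ≠ j → ‖A i j‖ ≤ n) (hq : q ∈ Q₀)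
    (hρ : l1 (q - pInf) ≤ ρ) : ‖coeff m₀ (subst A q) - 1‖ ≤ lipConst * n * ρ := by
  have := coeff_subst_sub_le hA.diag hn hAn hq hρ m₀_notMem_Δ₀
  rwa [hA.coeff_m₀_subst_pInf hw] at this

lemma norm_coeff_mShift_le (hA : IsUnitriangular w A)
    (hn : n ≤ 120) (hAn : ∀ i j, i ≠ j → ‖A i j‖ ≤ n) (hq : q ∈ Q₀)
    (hρ : l1 (q - pInf) ≤ ρ) {j k : Fin 5} (hjk : w j < w k) :
    ‖coeff (mShift j k) (subst A q)‖ ≤ lipConst * n * ρ := by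
  have := coeff_subst_sub_le hA.diag hn hAn hq hρ
    (mShift_notMem_Δ₀ fun h => hjk.ne (congrArg w h))
  rwa [hA.coeff_mShift_subst_pInf_of_lt hjk, sub_zero] at this

end IsUnitriangular

/-! ### Rigidity of the slice. -/

/-- The closeness to `p_∞` (in the `ℓ¹` norm) needed for the rigidity of the slice. -/
def rigidRadius : ℝ := (24000 * (recConst ^ 4 * lipConst))⁻¹

lemma rigidRadius_pos : 0 < rigidRadius := by
  have h1 : 0 < recConst := by norm_num [recConst]
  have h2 : 0 < lipConst := by norm_num [lipConst]
  rw [rigidRadius]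
  positivity

lemma recConst_mul_rigidRadius : recConst ^ 4 * (lipConst * rigidRadius) = 1 / 24000 := by
  have h1 : 0 < recConst := by norm_num [recConst]
  have h2 : 0 < lipConst := by norm_num [lipConst]
  rw [rigidRadius]
  field_simp

/-- This is `m_jk + e_j = m₀ + e_k`, written without division so that it needs no nonvanishing of
`d`. -/
lemma prod_pow_mShift (d : Fin 5 → ℂ) {j k : Fin 5} (hjk : j ≠ k) :
    (∏ i, d i ^ mShift j k i) * d j = (∏ i, d i) * d k := by
  have h : ∀ i, d i ^ mShift j k i * d i ^ (if i = j then 1 else 0) =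
      d i * d i ^ (if i = k then 1 else 0) := fun i => by
    rw [mShift_apply hjk]
    by_cases h1 : i = j
    · have h2 : i ≠ k := fun h => hjk (h1 ▸ h)
      simp [h1, hjk]
    · by_cases h2 : i = k
      · simp [h2, hjk.symm, pow_two]
      · simp [h1, h2]
  have h1 : ∏ i, d i ^ (if i = j then 1 else 0) = d j := by simp [pow_ite]
  have h2 : ∏ i, d i ^ (if i = k then 1 else 0) = d k := by simp [pow_ite]
  calc (∏ i, d i ^ mShift j k i) * d j
      = ∏ i, (d i ^ mShift j k i * d i ^ (if i = j then 1 else 0)) := by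
        rw [Finset.prod_mul_distrib, h1]
    _ = ∏ i, (d i * d i ^ (if i = k then 1 else 0)) := Finset.prod_congr rfl fun i _ => h i
    _ = (∏ i, d i) * d k := by rw [Finset.prod_mul_distrib, h2]

lemma prod_pow_m₀ (d : Fin 5 → ℂ) : ∏ i, d i ^ m₀ i = ∏ i, d i := by simp [m₀_apply]

lemma le_of_pivot_relation {D a x y : ℝ} (ha : 0 < a) (hD : 1 / 3 ≤ D)
    (h : D * a * x ≤ 32 * a * y) (hx : 0 ≤ x) : x ≤ 96 * y := by
  have h1 : 1 / 3 * (a * x) ≤ D * (a * x) := mul_le_mul_of_nonneg_right hD (mul_nonneg ha.le hx)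
  exact le_of_mul_le_mul_left (show a * x ≤ a * (96 * y) by linarith) ha

/-- A lower and an upper triangular substitution that agree up to a diagonal one are trivial. -/
theorem eq_one_of_subst_eq {L V : Matrix (Fin 5) (Fin 5) ℂ} {d : Fin 5 → ℂ} {q₁ q₂ : Poly}
    (hL1 : ∀ i, L i i = 1) (hL2 : ∀ i j, i < j → L i j = 0) (hL3 : ∀ i j, ‖L i j‖ ≤ 120)
    (hV1 : ∀ i, V i i = 1) (hV2 : ∀ i j, j < i → V i j = 0) (hV3 : ∀ i j, ‖V i j‖ ≤ 120)
    (hd : ∀ j k, k ≤ j → ‖d j‖ ≤ 32 * ‖d k‖) (hq₁ : q₁ ∈ Q₀) (hq₂ : q₂ ∈ Q₀)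
    (hρ₁ : l1 (q₁ - pInf) ≤ rigidRadius) (hρ₂ : l1 (q₂ - pInf) ≤ rigidRadius)
    (h : subst (L * diagonal d) q₁ = subst V q₂) : L = 1 ∧ V = 1 ∧ ∏ i, d i = 1 := by
  set w : Fin 5 → ℤ := fun i => (i : ℤ) with hw
  have hwi : Function.Injective w := fun i j hij => by
    simpa [hw, Fin.ext_iff] using hij
  have hwi' : Function.Injective (-w) := neg_injective.comp hwi |>.comp fun _ _ h => h
  have hw4 : ∀ i j, w i - w j ≤ 4 := fun i j => by simp only [hw]; omega
  have hw4' : ∀ i j, (-w) i - (-w) j ≤ 4 := fun i j => by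
    have := hw4 j i
    simp only [Pi.neg_apply]
    linarith
  have hwlt : ∀ {i j : Fin 5}, i < j → w i < w j := fun {i j} hij => by
    simpa [hw] using hij
  have hL : IsUnitriangular w L := ⟨hL1, fun i j hij hne => by
    rcases lt_or_gt_of_ne hij with hlt | hgt
    · exact absurd (hL2 i j hlt) hne
    · exact hwlt hgt⟩
  have hV : IsUnitriangular (-w) V := ⟨hV1, fun i j hij hne => by
    rcases lt_or_gt_of_ne hij with hlt | hgt
    · exact neg_lt_neg (hwlt hlt)
    · exact absurd (hV2 i j hgt) hne⟩
  obtain ⟨⟨a, b⟩, -, hmax⟩ := Finset.univ.exists_max_image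
    (fun p : Fin 5 × Fin 5 => if p.1 = p.2 then 0 else max ‖L p.1 p.2‖ ‖V p.1 p.2‖)
    ⟨(0, 0), Finset.mem_univ _⟩
  -- `n` is the largest off-diagonal absolute value in `L` and `V` together; the goal is `n = 0`.
  obtain ⟨n, hn⟩ : ∃ n, n = if a = b then 0 else max ‖L a b‖ ‖V a b‖ := ⟨_, rfl⟩
  have hmax' : ∀ i j, i ≠ j → max ‖L i j‖ ‖V i j‖ ≤ n := fun i j hij => by
    have := hmax (i, j) (Finset.mem_univ _)
    simp only [if_neg hij] at this
    rwa [hn]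
  have hLn : ∀ i j, i ≠ j → ‖L i j‖ ≤ n := fun i j hij => (le_max_left _ _).trans (hmax' i j hij)
  have hVn : ∀ i j, i ≠ j → ‖V i j‖ ≤ n := fun i j hij => (le_max_right _ _).trans (hmax' i j hij)
  have hn120 : n ≤ 120 := by
    rw [hn]
    split_ifs
    · norm_num
    · exact max_le (hL3 _ _) (hV3 _ _)
  have hn0 : 0 ≤ n := (norm_nonneg _).trans (hLn 0 1 (by decide))
  have hrec : 1 ≤ recConst := by norm_num [recConst]
  have hlip : 0 < lipConst := by norm_num [lipConst]
  set y := lipConst * n * rigidRadius with hy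
  have hy0 : 0 ≤ y := mul_nonneg (mul_nonneg hlip.le hn0) rigidRadius_pos.le
  have hRy : recConst ^ 4 * y = n / 24000 := by
    rw [hy]
    linear_combination n * recConst_mul_rigidRadius
  have hyle : y ≤ n / 24000 := by
    rw [← hRy]
    exact le_mul_of_one_le_left hy0 (one_le_pow₀ hrec)
  have hcoef : ∀ m, (∏ i, d i ^ m i) * coeff m (subst L q₁) = coeff m (subst V q₂) := fun m => by
    rw [← h, ← subst_subst, coeff_subst_diagonal]
  have hx1 := hL.norm_coeff_m₀_sub_one_le hwi hn120 hLn hq₁ hρ₁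
  have hx2 := hV.norm_coeff_m₀_sub_one_le hwi' hn120 hVn hq₂ hρ₂
  have hx := hcoef m₀
  rw [prod_pow_m₀] at hx
  set D := ∏ i, d i with hD
  set x1 := coeff m₀ (subst L q₁)
  set x2 := coeff m₀ (subst V q₂)
  have hbd : ∀ {x : ℂ}, ‖x - 1‖ ≤ y → 1 / 2 ≤ ‖x‖ ∧ ‖x‖ ≤ 3 / 2 := fun {x} hx => by
    have h1 := norm_sub_norm_le (1 : ℂ) x
    have h2 := norm_sub_norm_le x (1 : ℂ)
    rw [norm_one, norm_sub_rev] at h1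
    rw [norm_one] at h2
    constructor <;> linarith
  obtain ⟨l1', u1⟩ := hbd hx1
  obtain ⟨l2, u2⟩ := hbd hx2
  have hDx : ‖D‖ * ‖x1‖ = ‖x2‖ := by rw [← norm_mul, hx]
  have hD3 : ‖D‖ ≤ 3 := by nlinarith [norm_nonneg D]
  have hD13 : 1 / 3 ≤ ‖D‖ := by nlinarith [norm_nonneg D]
  have hD0 : D ≠ 0 := norm_pos_iff.mp (by linarith)
  have hdpos : ∀ i, 0 < ‖d i‖ := fun i =>
    norm_pos_iff.mpr (Finset.prod_ne_zero_iff.mp hD0 i (Finset.mem_univ i))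
  have hrel : ∀ j k, j ≠ k → ‖D‖ * ‖d k‖ * ‖coeff (mShift j k) (subst L q₁)‖ =
      ‖d j‖ * ‖coeff (mShift j k) (subst V q₂)‖ := fun j k hjk => by
    rw [← norm_mul, ← norm_mul, ← norm_mul, ← hcoef, ← prod_pow_mShift d hjk]
    congr 1
    ring
  -- Below the diagonal `V` contributes only through `q₂ - p_∞`, hence at most `y`. The relation
  -- `hrel` transfers this to `L` with the factor `‖d j‖ / (‖D‖ ‖d k‖) ≤ 3 · 32`; `hγV` is the
  -- mirror image above the diagonal.
  have hγL : ∀ j k, w k < w j → ‖coeff (mShift j k) (subst L q₁)‖ ≤ 96 * y := fun j k hkj => by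
    have hjk : j ≠ k := fun e => hkj.ne' (congrArg w e)
    have hle : k ≤ j := by
      by_contra! hc
      exact lt_asymm hkj (hwlt hc)
    have h1 := hV.norm_coeff_mShift_le hn120 hVn hq₂ hρ₂ (j := j) (k := k) (neg_lt_neg hkj)
    have h2 := hrel j k hjk
    have h3 := hd j k hle
    have h4 : ‖d j‖ * ‖coeff (mShift j k) (subst V q₂)‖ ≤ 32 * ‖d k‖ * y :=
      mul_le_mul h3 h1 (norm_nonneg _) (by linarith [hdpos k])
    exact le_of_pivot_relation (hdpos k) hD13 (h2.trans_le h4) (norm_nonneg _)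
  have hγV : ∀ j k, (-w) k < (-w) j → ‖coeff (mShift j k) (subst V q₂)‖ ≤ 96 * y :=
      fun j k hkj => by
    have hjk' : w j < w k := neg_lt_neg_iff.mp hkj
    have hjk : j ≠ k := fun e => hjk'.ne (congrArg w e)
    have hle : j ≤ k := by
      by_contra! hc
      exact lt_asymm hjk' (hwlt hc)
    have h1 := hL.norm_coeff_mShift_le hn120 hLn hq₁ hρ₁ hjk'
    have h2 := hrel j k hjk
    have h3 := hd k j hle
    have h4 : ‖D‖ * ‖d k‖ * ‖coeff (mShift j k) (subst L q₁)‖ ≤ 3 * (32 * ‖d j‖) * y :=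
      mul_le_mul (mul_le_mul hD3 h3 (norm_nonneg _) (by norm_num)) h1 (norm_nonneg _)
        (mul_nonneg (by norm_num) (mul_nonneg (by norm_num) (norm_nonneg _)))
    have h5 : 3 * (32 * ‖d j‖) * y = ‖d j‖ * (96 * y) := by ring
    exact le_of_mul_le_mul_left (h2.symm.trans_le (h4.trans h5.le)) (hdpos j)
  have hLe := hL.norm_le_of_coeff_le hwi hw4 hn120 hLn hq₁ hρ₁ hγL
  have hVe := hV.norm_le_of_coeff_le hwi' hw4' hn120 hVn hq₂ hρ₂ hγV
  -- By the choice of `rigidRadius` the left side is `97 n / 24000`.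
  have hsmall : recConst ^ 4 * (96 * y + lipConst * n * rigidRadius) ≤ n / 2 := by
    rw [← hy]
    have : recConst ^ 4 * (96 * y + y) = 97 * (recConst ^ 4 * y) := by ring
    rw [this, hRy]
    linarith
  have hnz : n = 0 := by
    refine le_antisymm ?_ hn0
    by_cases hab : a = b
    · rw [hn, if_pos hab]
    · have : n ≤ n / 2 := by
        conv_lhs => rw [hn, if_neg hab]
        exact max_le ((hLe a b hab).trans hsmall) ((hVe a b hab).trans hsmall)
      linarith
  have hone : ∀ {A : Matrix (Fin 5) (Fin 5) ℂ}, (∀ i, A i i = 1) →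
      (∀ i j, i ≠ j → ‖A i j‖ ≤ n) → A = 1 := fun {A} h1 h2 => by
    ext i j
    by_cases hij : i = j
    · rw [hij, h1, Matrix.one_apply_eq]
    · rw [Matrix.one_apply_ne hij, ← norm_le_zero_iff, ← hnz]
      exact h2 i j hij
  refine ⟨hone hL1 hLn, hone hV1 hVn, ?_⟩
  have hy00 : y = 0 := by rw [hy, hnz]; ring
  rw [← hy, hy00, norm_le_zero_iff, sub_eq_zero] at hx1 hx2
  rwa [hx1, hx2, mul_one] at hx

/-- A substitution that maps a point of `Q₀` near `p_∞` to a point of `Q₀` near `p_∞` is the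
product of an element of the torus and a permutation. -/
theorem eq_diagonal_mul_permMatrix {A : Matrix (Fin 5) (Fin 5) ℂ} {q : Poly} (hq : q ∈ Q₀)
    (hAq : subst A q ∈ Q₀) {ε : ℝ} (hε : degFive.card * ε ≤ rigidRadius)
    (hn : Near ε q pInf) (hAn : Near ε (subst A q) pInf) :
    ∃ (d : Fin 5 → ℂ) (π : Equiv.Perm (Fin 5)),
      ∏ i, d i = 1 ∧ A = diagonal d * π.permMatrix ℂ := by
  obtain ⟨σ, τ, L, V, d, ⟨hL1, hL2, hL3⟩, ⟨hV1, hV2, hV3⟩, hE, hd, -⟩ :=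
    exists_complete_pivoting 5 A
  have hsub : A.submatrix σ τ = σ.permMatrix ℂ * A * (τ⁻¹).permMatrix ℂ := by
    ext i j
    simp [PEquiv.toMatrix_toPEquiv_mul, PEquiv.mul_toMatrix_toPEquiv]
    rfl
  have hρ : ∀ {p : Poly}, p ∈ Q₀ → Near ε p pInf → l1 (p - pInf) ≤ rigidRadius :=
      fun {p} hp hnp =>
    (l1_le_of_coeff_le (Q.sub_mem (mem_Q₀_iff.mp hp).1 pInf_mem_Q) fun m => by
      rw [coeff_sub]
      exact (hnp m).le).trans hε
  have hback : rename σ (rename (⇑σ⁻¹) q) = q := by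
    rw [rename_rename]
    have : σ ∘ ⇑σ⁻¹ = id := funext fun i => σ.apply_symm_apply i
    rw [this, rename_id_apply]
  -- The pivoting permutations are moved onto the quintics; this is harmless, since `Q₀` and the
  -- distance to `p_∞` are invariant under permutations.
  have heq : subst (L * diagonal d) (rename (⇑σ⁻¹) q) = subst V (rename (⇑τ⁻¹) (subst A q)) := by
    rw [← hE, hsub, ← subst_subst, ← subst_subst, ← subst_subst, subst_permMatrix,
      subst_permMatrix, hback]
  obtain ⟨hL, hV, hD⟩ := eq_one_of_subst_eq hL1 hL2
    (fun i j => (hL3 i j).trans (by norm_num)) hV1 hV2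
    (fun i j => (hV3 i j).trans (by norm_num [Nat.factorial]))
    (fun j k hkj => (hd j k hkj).trans (by norm_num))
    (rename_mem_Q₀ _ hq) (rename_mem_Q₀ _ hAq) (hρ (rename_mem_Q₀ _ hq) (near_rename _ hn))
    (hρ (rename_mem_Q₀ _ hAq) (near_rename _ hAn)) heq
  rw [hL, hV, mul_one, one_mul] at hE
  refine ⟨fun i => d (σ⁻¹ i), τ * σ⁻¹, ?_, ?_⟩
  · rw [← hD]
    exact Equiv.prod_comp σ⁻¹ d
  · ext i j
    have h1 : A (σ (σ⁻¹ i)) (τ (τ⁻¹ j)) = diagonal d (σ⁻¹ i) (τ⁻¹ j) :=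
      congrFun (congrFun hE (σ⁻¹ i)) (τ⁻¹ j)
    have h2 : σ (σ⁻¹ i) = i := σ.apply_symm_apply i
    have h3 : τ (τ⁻¹ j) = j := τ.apply_symm_apply j
    rw [h2, h3] at h1
    rw [h1, diagonal_mul, diagonal_apply]
    simp only [Equiv.Perm.permMatrix, PEquiv.toMatrix_apply, Equiv.toPEquiv_apply,
      Option.mem_def, Option.some.injEq, Equiv.Perm.mul_apply, mul_ite, mul_one, mul_zero,
      Equiv.Perm.eq_inv_iff_eq]

/-! ### Torus orbits -/

lemma mem_torusOrbit_iff_diagonal {F G : Poly} : G ∈ torusOrbit F ↔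
    ∃ d : Fin 5 → ℂ, ∏ i, d i = 1 ∧ G = subst (diagonal d) F := by
  rw [mem_torusOrbit_iff]
  constructor
  · rintro ⟨t, ht, rfl⟩
    obtain ⟨d, hd, hd1⟩ := exists_diagonal_of_mem_torus ht
    exact ⟨d, hd1, by rw [hd]⟩
  · rintro ⟨d, hd1, rfl⟩
    obtain ⟨t, ht, htd⟩ := exists_torus_eq_diagonal hd1
    exact ⟨t, ht, by rw [htd]⟩

lemma prod_inv_eq_one {d : Fin 5 → ℂ} (hd : ∏ i, d i = 1) : ∏ i, d⁻¹ i = 1 := by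
  simp only [Pi.inv_apply, Finset.prod_inv_distrib, hd, inv_one]

lemma diagonal_mul_diagonal_inv {d : Fin 5 → ℂ} (hd : ∏ i, d i = 1) :
    diagonal d * diagonal d⁻¹ = 1 := by
  rw [diagonal_mul_diagonal, ← diagonal_one]
  congr 1
  funext i
  refine mul_inv_cancel₀ fun h => ?_
  rw [Finset.prod_eq_zero (Finset.mem_univ i) h] at hd
  exact zero_ne_one hd

lemma torusOrbit_subst_diagonal {d : Fin 5 → ℂ} (hd : ∏ i, d i = 1) (F : Poly) :
    torusOrbit (subst (diagonal d) F) = torusOrbit F := by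
  have key : ∀ {d : Fin 5 → ℂ} (_ : ∏ i, d i = 1) (F : Poly),
      torusOrbit (subst (diagonal d) F) ⊆ torusOrbit F := fun {d} hd F G hG => by
    obtain ⟨s, hs, rfl⟩ := mem_torusOrbit_iff_diagonal.mp hG
    refine mem_torusOrbit_iff_diagonal.mpr ⟨fun i => d i * s i, ?_, ?_⟩
    · rw [Finset.prod_mul_distrib, hd, hs, one_mul]
    · rw [subst_subst, diagonal_mul_diagonal]
  refine (key hd F).antisymm ?_
  have := key (prod_inv_eq_one hd) (subst (diagonal d) F)
  rwa [subst_subst, diagonal_mul_diagonal_inv hd, subst_one] at this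

lemma diagonal_mul_permMatrix (d : Fin 5 → ℂ) (σ : Equiv.Perm (Fin 5)) :
    diagonal (d ∘ σ) * σ.permMatrix ℂ = σ.permMatrix ℂ * diagonal d := by
  ext i j
  rw [diagonal_mul, mul_diagonal]
  simp only [Equiv.Perm.permMatrix, PEquiv.toMatrix_apply, Equiv.toPEquiv_apply, Option.mem_def,
    Option.some.injEq, Function.comp_apply]
  by_cases h : σ i = j <;> simp [h]

lemma rename_subst_diagonal (d : Fin 5 → ℂ) (σ : Equiv.Perm (Fin 5)) (F : Poly) :
    rename σ (subst (diagonal d) F) = subst (diagonal (d ∘ ⇑σ⁻¹)) (rename σ F) := by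
  have h := diagonal_mul_permMatrix (d ∘ ⇑σ⁻¹) σ
  have e : (d ∘ ⇑σ⁻¹) ∘ σ = d := funext fun i => congrArg d (σ.symm_apply_apply i)
  rw [e] at h
  rw [← subst_permMatrix, ← subst_permMatrix, subst_subst, subst_subst, h]

/-- Permutation matrices normalize `T`, so `S₅` acts on the set of `T`-orbits. -/
lemma torusOrbit_rename (σ : Equiv.Perm (Fin 5)) (F : Poly) :
    torusOrbit (rename σ F) = rename σ '' torusOrbit F := by
  ext G
  rw [Set.mem_image, mem_torusOrbit_iff_diagonal]
  constructor
  · rintro ⟨d, hd, rfl⟩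
    refine ⟨subst (diagonal (d ∘ σ)) F, mem_torusOrbit_iff_diagonal.mpr ⟨_, ?_, rfl⟩, ?_⟩
    · rw [← hd]
      exact Equiv.prod_comp σ d
    · rw [rename_subst_diagonal]
      have e : (d ∘ σ) ∘ ⇑σ⁻¹ = d := funext fun i => congrArg d (σ.apply_symm_apply i)
      rw [e]
  · rintro ⟨H, hH, rfl⟩
    obtain ⟨d, hd, rfl⟩ := mem_torusOrbit_iff_diagonal.mp hH
    refine ⟨d ∘ ⇑σ⁻¹, ?_, rename_subst_diagonal d σ F⟩
    rw [← hd]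
    exact Equiv.prod_comp σ⁻¹ d

lemma rename_mul (σ τ : Equiv.Perm (Fin 5)) (F : Poly) :
    rename (⇑(σ * τ)) F = rename σ (rename τ F) := by
  rw [rename_rename]
  rfl

lemma torusOrbit_rename_mul (σ τ : Equiv.Perm (Fin 5)) (F : Poly) :
    torusOrbit (rename (⇑(σ * τ)) F) = rename σ '' torusOrbit (rename τ F) := by
  rw [rename_mul, torusOrbit_rename]

lemma rename_perm_one (F : Poly) : rename (⇑(1 : Equiv.Perm (Fin 5))) F = F := rename_id_apply F

/-- The permutations that preserve the torus orbit of `F`. -/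
def weylStabilizer (F : Poly) : Subgroup (Equiv.Perm (Fin 5)) where
  carrier := {σ | torusOrbit (rename σ F) = torusOrbit F}
  one_mem' := congrArg torusOrbit (rename_perm_one F)
  mul_mem' {σ τ} hσ hτ := by
    change torusOrbit _ = _ at hσ hτ ⊢
    rw [torusOrbit_rename_mul, hτ, ← torusOrbit_rename, hσ]
  inv_mem' {σ} hσ := by
    change torusOrbit _ = _ at hσ ⊢
    rw [torusOrbit_rename, ← hσ, ← torusOrbit_rename, ← rename_mul, inv_mul_cancel,
      rename_perm_one]
    exact hσ.symm

lemma inv_mul_mem_weylStabilizer_iff {σ τ : Equiv.Perm (Fin 5)} {F : Poly} :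
    σ⁻¹ * τ ∈ weylStabilizer F ↔ torusOrbit (rename σ F) = torusOrbit (rename τ F) := by
  change torusOrbit _ = torusOrbit F ↔ _
  constructor
  · intro h
    rw [torusOrbit_rename σ F, ← h, ← torusOrbit_rename, ← rename_mul, mul_inv_cancel_left]
  · intro h
    rw [torusOrbit_rename_mul, ← h, ← torusOrbit_rename, ← rename_mul, inv_mul_cancel,
      rename_perm_one]

/-- Orbit–stabilizer for the action of `S₅` on `T`-orbits; the image of `σ` depends only on its left
coset. -/
lemma exists_equiv_range_torusOrbit (F : Poly) :
    ∃ e : (Equiv.Perm (Fin 5) ⧸ weylStabilizer F) ≃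
        ↥(Set.range fun σ : Equiv.Perm (Fin 5) => torusOrbit (rename σ F)),
      ∀ σ : Equiv.Perm (Fin 5),
        (e (QuotientGroup.mk σ) : Set Poly) = torusOrbit (rename σ F) := by
  let f : (Equiv.Perm (Fin 5) ⧸ weylStabilizer F) →
      ↥(Set.range fun σ : Equiv.Perm (Fin 5) => torusOrbit (rename σ F)) :=
    Quotient.lift (fun σ => ⟨torusOrbit (rename σ F), σ, rfl⟩) fun σ τ h =>
      Subtype.ext (inv_mul_mem_weylStabilizer_iff.mp (QuotientGroup.leftRel_apply.mp h))
  refine ⟨Equiv.ofBijective f ⟨?_, ?_⟩, fun σ => rfl⟩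
  · intro x y
    induction x using QuotientGroup.induction_on with | H σ => ?_
    induction y using QuotientGroup.induction_on with | H τ => ?_
    intro h
    exact QuotientGroup.eq.mpr (inv_mul_mem_weylStabilizer_iff.mpr (congrArg Subtype.val h))
  · rintro ⟨_, σ, rfl⟩
    exact ⟨QuotientGroup.mk σ, rfl⟩

/-! ### The slice and the group action -/

lemma rename_mem_slice {ε : ℝ} {q : Poly} (hq : q ∈ slice ε) (σ : Equiv.Perm (Fin 5)) :
    rename σ q ∈ slice ε := by
  obtain ⟨q₁, hq₁, hn, h⟩ := hq
  refine ⟨rename σ q₁, rename_mem_Q₀ σ hq₁, near_rename σ hn, ?_⟩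
  rw [torusOrbit_rename]
  exact ⟨q, h, rfl⟩

lemma rename_mem_glOrbit {p q : Poly} (hq : q ∈ glOrbit p) (σ : Equiv.Perm (Fin 5)) :
    rename σ q ∈ glOrbit p := by
  obtain ⟨g, rfl⟩ := hq
  have hu : IsUnit (σ.permMatrix ℂ) := by
    rw [isUnit_iff_isUnit_det, det_permutation]
    exact (Equiv.Perm.sign σ).isUnit.map (Int.castRingHom ℂ)
  refine mem_glOrbit_iff.mpr ⟨g * hu.unit, ?_⟩
  rw [Units.val_mul, ← subst_subst, IsUnit.unit_spec, subst_permMatrix]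

/-- A substitution carrying a point of the slice into the slice lies in `T ⋊ S₅`. -/
theorem eq_diagonal_mul_permMatrix_of_mem_slice {ε : ℝ}
    (hε : degFive.card * ε ≤ rigidRadius) {A : Matrix (Fin 5) (Fin 5) ℂ} {q : Poly}
    (hq : q ∈ slice ε) (hAq : subst A q ∈ slice ε) :
    ∃ (d : Fin 5 → ℂ) (π : Equiv.Perm (Fin 5)),
      ∏ i, d i = 1 ∧ A = diagonal d * π.permMatrix ℂ := by
  obtain ⟨q₁, hq₁, hn₁, h₁⟩ := hq
  obtain ⟨q₂, hq₂, hn₂, h₂⟩ := hAq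
  obtain ⟨a, ha, rfl⟩ := mem_torusOrbit_iff_diagonal.mp h₁
  obtain ⟨b, hb, hb'⟩ := mem_torusOrbit_iff_diagonal.mp h₂
  -- Torus factors on both sides replace the two points of the slice by representatives close to
  -- `p_∞`, where the rigidity for `Q₀` applies.
  have e : subst (diagonal a * A * diagonal b⁻¹) q₁ = q₂ := by
    rw [← subst_subst, ← subst_subst, hb', subst_subst, diagonal_mul_diagonal_inv hb, subst_one]
  obtain ⟨d, π, hd, hA⟩ := eq_diagonal_mul_permMatrix hq₁ (e ▸ hq₂) hε hn₁ (e ▸ hn₂)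
  refine ⟨fun i => a⁻¹ i * d i * b (π i), π, ?_, ?_⟩
  · rw [Finset.prod_mul_distrib, Finset.prod_mul_distrib, prod_inv_eq_one ha, hd,
      Equiv.prod_comp π b, hb, one_mul, one_mul]
  · have ha' : diagonal a⁻¹ * diagonal a = 1 :=
      mul_eq_one_comm.mp (diagonal_mul_diagonal_inv ha)
    have hb'' : diagonal b⁻¹ * diagonal b = 1 :=
      mul_eq_one_comm.mp (diagonal_mul_diagonal_inv hb)
    calc A = diagonal a⁻¹ * diagonal a * A * (diagonal b⁻¹ * diagonal b) := by
          rw [ha', hb'', one_mul, mul_one]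
      _ = diagonal a⁻¹ * (diagonal a * A * diagonal b⁻¹) * diagonal b := by
          simp only [Matrix.mul_assoc]
      _ = diagonal a⁻¹ * diagonal d * (π.permMatrix ℂ * diagonal b) := by
          rw [hA]
          simp only [Matrix.mul_assoc]
      _ = _ := by
          rw [← diagonal_mul_permMatrix, ← Matrix.mul_assoc, diagonal_mul_diagonal,
            diagonal_mul_diagonal]
          rfl

/-- Two points of the orbit in the slice differ by a group element, which by rigidity is a torus
element times a permutation; the torus part does not change the `T`-orbit. Conversely, the orbit and
the slice are stable under permutations. -/
theorem torusOrbit_image_eq_range {ε : ℝ} (hε : degFive.card * ε ≤ rigidRadius) {p q : Poly}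
    (hq : q ∈ glOrbit p ∩ slice ε) :
    torusOrbit '' (glOrbit p ∩ slice ε) =
      Set.range fun σ : Equiv.Perm (Fin 5) => torusOrbit (rename σ q) := by
  ext S
  constructor
  · rintro ⟨q', ⟨hg', hs'⟩, rfl⟩
    obtain ⟨g, hg⟩ := mem_glOrbit_iff.mp hq.1
    obtain ⟨g', hg'⟩ := mem_glOrbit_iff.mp hg'
    have e : q' = subst ((g⁻¹ * g' : GL (Fin 5) ℂ) : Matrix (Fin 5) (Fin 5) ℂ) q := by
      rw [hg, subst_subst, ← Units.val_mul, mul_inv_cancel_left, hg']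
    obtain ⟨d, π, hd, hA⟩ := eq_diagonal_mul_permMatrix_of_mem_slice hε hq.2 (e ▸ hs')
    refine ⟨π, ?_⟩
    change torusOrbit (rename π q) = torusOrbit q'
    rw [e, hA, ← subst_subst, subst_permMatrix, torusOrbit_rename, torusOrbit_rename,
      torusOrbit_subst_diagonal hd]
  · rintro ⟨σ, rfl⟩
    exact ⟨rename σ q, ⟨rename_mem_glOrbit hq.1 σ, rename_mem_slice hq.2 σ⟩, rfl⟩

end Quintic

end

theorem mainTheorem7 :
    -- `Q₀` lies in `Q`, contains `p_∞` and is invariant under `T`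
    (∀ q ∈ Quintic.Q₀, q ∈ Quintic.Q) ∧
    Quintic.pInf ∈ Quintic.Q₀ ∧
    (∀ t ∈ Quintic.torus, ∀ q ∈ Quintic.Q₀,
      Quintic.subst (t : Matrix (Fin 5) (Fin 5) ℂ) q ∈ Quintic.Q₀) ∧
    (∃ ε₀ : ℝ, 0 < ε₀ ∧ ∀ ε : ℝ, 0 < ε → ε ≤ ε₀ →
      -- the orbits that meet the slice near `p_∞` fill an open neighbourhood of `p_∞` in `Q`
      Quintic.pInf ∈ Quintic.nearby ε ∧
      (∀ p ∈ Quintic.nearby ε, ∃ δ : ℝ, 0 < δ ∧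
        ∀ p' ∈ Quintic.Q, Quintic.Near δ p' p → p' ∈ Quintic.nearby ε) ∧
      -- a group element that carries a point of the slice into the slice is in `T ⋊ S₅`
      (∀ g : GL (Fin 5) ℂ, ∀ q ∈ Quintic.slice ε,
        Quintic.subst (g : Matrix (Fin 5) (Fin 5) ℂ) q ∈ Quintic.slice ε →
        ∃ t ∈ Quintic.torus, ∃ σ : Equiv.Perm (Fin 5),
          (g : Matrix (Fin 5) (Fin 5) ℂ) =
            (t : Matrix (Fin 5) (Fin 5) ℂ) * Equiv.Perm.permMatrix ℂ σ) ∧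
      -- each nearby orbit meets the slice in finitely many `T`-orbits, indexed by `S₅ / H`
      (∀ p ∈ Quintic.nearby ε,
        (Quintic.torusOrbit '' (Quintic.glOrbit p ∩ Quintic.slice ε)).Finite ∧
        ∀ q ∈ Quintic.glOrbit p ∩ Quintic.slice ε,
          ∃ (H : Subgroup (Equiv.Perm (Fin 5)))
            (e : (Equiv.Perm (Fin 5) ⧸ H) ≃
              ↥(Quintic.torusOrbit '' (Quintic.glOrbit p ∩ Quintic.slice ε))),
            ∀ σ : Equiv.Perm (Fin 5),
              (e (QuotientGroup.mk σ) : Set Quintic.Poly) =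
                Quintic.torusOrbit (MvPolynomial.rename σ q))) ∧
    -- for large `ψ` the product `L_1 L_2 ⋯` converges and brings `F` to the normal form
    (∀ c : ℝ, ∃ R K : ℝ, 0 < R ∧ ∀ F ∈ Quintic.Q,
      (∀ m, m ≠ Quintic.m₀ → ‖MvPolynomial.coeff m F‖ ≤ c) →
      R ≤ ‖MvPolynomial.coeff Quintic.m₀ F‖ →
      (∀ l i j, ‖(Quintic.step (Quintic.iter F l) - 1) i j‖ ≤
        (K / ‖MvPolynomial.coeff Quintic.m₀ F‖) ^ (l + 1)) ∧
      ∃ L : GL (Fin 5) ℂ,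
        Tendsto (Quintic.partialProd F) atTop (𝓝 (L : Matrix (Fin 5) (Fin 5) ℂ)) ∧
        MvPolynomial.coeff Quintic.m₀
          (Quintic.subst (L : Matrix (Fin 5) (Fin 5) ℂ) F) ≠ 0 ∧
        (MvPolynomial.coeff Quintic.m₀
            (Quintic.subst (L : Matrix (Fin 5) (Fin 5) ℂ) F))⁻¹ •
          Quintic.subst (L : Matrix (Fin 5) (Fin 5) ℂ) F ∈ Quintic.Q₀) := by

  refine ⟨fun q hq => (Quintic.mem_Q₀_iff.mp hq).1, Quintic.pInf_mem_Q₀,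
    fun t ht q hq => Quintic.subst_torus_mem_Q₀ ht hq, ?_, Quintic.normalForm_of_large⟩
  have hcard : (0 : ℝ) < Quintic.degFive.card :=
    zero_lt_one.trans_le Quintic.one_le_card_degFive
  -- The first bound serves openness, the second rigidity, where `degFive.card` converts a bound on
  -- coefficients into one on `l1`.
  refine ⟨min Quintic.radius (Quintic.rigidRadius / Quintic.degFive.card),
    lt_min Quintic.radius_pos (div_pos Quintic.rigidRadius_pos hcard), fun ε hε hle => ?_⟩
  have hε1 : ε ≤ Quintic.radius := hle.trans (min_le_left _ _)
  have hε2 : Quintic.degFive.card * ε ≤ Quintic.rigidRadius := by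
    rw [mul_comm, ← le_div_iff₀ hcard]
    exact hle.trans (min_le_right _ _)
  refine ⟨Quintic.pInf_mem_nearby hε, fun p hp => Quintic.isOpen_nearby hε1 hp,
    fun g q hq hgq => ?_, fun p hp => ?_⟩
  · obtain ⟨d, π, hd, hg⟩ := Quintic.eq_diagonal_mul_permMatrix_of_mem_slice hε2 hq hgq
    obtain ⟨t, ht, htd⟩ := Quintic.exists_torus_eq_diagonal hd
    exact ⟨t, ht, π, by rw [hg, htd]⟩
  · obtain ⟨q₀, hq₀⟩ := hp.2
    refine ⟨?_, fun q hq => ⟨Quintic.weylStabilizer q, ?_⟩⟩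
    · rw [Quintic.torusOrbit_image_eq_range hε2 hq₀]
      exact Set.finite_range _
    · rw [Quintic.torusOrbit_image_eq_range hε2 hq]
      exact Quintic.exists_equiv_range_torusOrbit q
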